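/- Let $F$ be a finite simple graph with vertex set $\{1,\ldots,m\}$ that has at least one edge and contains twins, i.e. two distinct vertices with the same set of neighbours. Let $0<p\le 1$, and let $\alpha_1,\ldots,\alpha_m\in(0,1)$ satisfy $\sum_{i=1}^m\alpha_i\le 1$. Then $\mathcal P(F,\alpha_1,\ldots,\alpha_m)$ is a quasi-random property. That is, a graphon $W$ (a symmetric measurable function $W:[0,1]^2\to[0,1]$) satisfies $$\int_{A_1\times\cdots\times A_m}\ \prod_{\{i,j\}\in E(F)} W(x_i,x_j)\,dx_1\cdots dx_m \;=\; p^{|E(F)|}\prod_{i=1}^m\alpha_i$$ for all pairwise disjoint measurable sets $A_1,\ldots,A_m\subseteq[0,1]$ of respective Lebesgue measures $\alpha_1,\ldots,\alpha_m$ if and only if $W=p$ almost everywhere on $[0,1]^2$. -/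

import Mathlib

open MeasureTheory unitInterval

/-- A graphon: a symmetric (Lebesgue) measurable function `[0,1]² → [0,1]`. Lebesgue
measurability is almost everywhere measurability with respect to the Lebesgue measure. -/
structure Graphon where
  /-- The underlying function on the unit square. -/
  toFun : I → I → ℝ
  aemeasurable : AEMeasurable (fun z : I × I => toFun z.1 z.2) volume
  symm : ∀ x y, toFun x y = toFun y x
  mem_unitInterval : ∀ x y, toFun x y ∈ I

namespace Graphon

/-- The value `W(x_i, x_j)` at an edge `e = {i, j}`; well defined since `W` is symmetric. -/
def edgeValue (W : Graphon) {m : ℕ} (x : Fin m → I) (e : Sym2 (Fin m)) : ℝ :=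
  e.lift ⟨fun i j => W.toFun (x i) (x j), fun i j => W.symm (x i) (x j)⟩

/-- The product `∏_{ij ∈ E(F)} W(x_i, x_j)`. -/
def edgeProd (W : Graphon) {m : ℕ} (F : SimpleGraph (Fin m)) [DecidableRel F.Adj]
    (x : Fin m → I) : ℝ :=
  ∏ e ∈ F.edgeFinset, W.edgeValue x e

/-- The property `P(F, α_1, …, α_m)` for a graphon `W` and density `p`: for all disjoint
measurable sets `A_1, …, A_m ⊆ [0,1]` of measures `α_1, …, α_m`, the integral of
`∏_{ij ∈ E(F)} W(x_i, x_j)` over `A_1 × ⋯ × A_m` is `p^{|E(F)|} ∏ α_i`. -/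
def SatisfiesP (W : Graphon) {m : ℕ} (F : SimpleGraph (Fin m)) [DecidableRel F.Adj]
    (α : Fin m → ℝ) (p : ℝ) : Prop :=
  ∀ A : Fin m → Set I,
    (∀ i, MeasurableSet (A i)) →
    (∀ i j, i ≠ j → Disjoint (A i) (A j)) →
    (∀ i, volume.real (A i) = α i) →
    ∫ x in Set.univ.pi A, W.edgeProd F x = p ^ F.edgeFinset.card * ∏ i, α i

/-- `W` equals the constant `p` (almost everywhere). -/
def AEEqConst (W : Graphon) (p : ℝ) : Prop :=
  ∀ᵐ z : I × I, W.toFun z.1 z.2 = p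

end Graphon

/-- `P(F, α_1, …, α_m)` is a quasi-random property (for density `p`): the constant `p` is,
up to almost everywhere equality, the one and only graphon that satisfies it. -/
def IsQuasiRandomProperty {m : ℕ} (F : SimpleGraph (Fin m)) [DecidableRel F.Adj]
    (α : Fin m → ℝ) (p : ℝ) : Prop :=
  ∀ W : Graphon, W.SatisfiesP F α p ↔ W.AEEqConst p

/-- Two distinct vertices are twins if they have the same neighbours. -/
def SimpleGraph.AreTwins {V : Type*} (F : SimpleGraph V) (u v : V) : Prop :=
  u ≠ v ∧ F.neighborSet u = F.neighborSet v

/-!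
# Subgraph counts of graphs with twins force quasi-randomness

Write `f x = ∏_{ij ∈ E(F)} W (x i, x j)` and call the integral of `f` over `A₁ × ⋯ × A_m` the box
integral. A box with sides of the measures `α i` may fill the whole interval, so no side can be
varied on its own; the twins `u`, `v` overcome this.

With the other coordinates fixed, `f` is a product `φ (x u) * φ (x v)` (`edgeProd_update_update`),
so for fixed other sides the box integral is `∫ (∫_{A u} φ) (∫_{A v} φ)`, a positive semidefinite
form in `A u` and `A v`. Redistributing `D = A u ∪ A v` between the two sides shows that the form
vanishes on pairs of differences `1_B₁ - 1_C₁`, `1_B₂ - 1_C₂` with disjoint supports and mean zero.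
Positivity then gives `∫_B φ = ∫_C φ` almost everywhere whenever `B, C ⊆ D` are disjoint, small and
of equal measure (`ae_sliceIntegral_eq`), and so the box integral is proportional to the measure
of the side `u` (`setIntegral_pi_of_lt_of_twins`).

Once the side `u` is shortened there is room to exchange small sets between any other side and the
complement of the box sides, and side by side the box integral is seen to be
`p ^ |E(F)| * ∏ |A i|` for all disjoint small sides (`setIntegral_pi_of_forall_lt`). Hence
`f = p ^ |E(F)|` almost everywhere (`ae_eq_const_of_setIntegral_pi`).

For almost every choice of `m + 2` points, all copies of `F` on these points therefore have the
same positive weight. Moving one vertex of a copy, and one of its neighbours, to the two unused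
points shows that all edges have equal weight (`toFun_eq_of_forall_edgeProd_eq`), which must be `p`.
-/

/-! ### Subsets of given measure, resampling a coordinate, and constant densities -/

theorem exists_subset_measureReal_eq {S : Set I} (hS : MeasurableSet S) {r : ℝ} (h0 : 0 ≤ r)
    (hr : r ≤ volume.real S) : ∃ T ⊆ S, MeasurableSet T ∧ volume.real T = r := by
  have key : ∀ s t : I, s ≤ t →
      |volume.real (S ∩ Set.Iic t) - volume.real (S ∩ Set.Iic s)| ≤ (t : ℝ) - s := by
    intro s t hst
    have h1 : volume.real (S ∩ Set.Iic s) ≤ volume.real (S ∩ Set.Iic t) :=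
      measureReal_mono (Set.inter_subset_inter_right _ (Set.Iic_subset_Iic.2 hst))
    have h2 : volume.real (S ∩ Set.Iic t) ≤
        volume.real (S ∩ Set.Iic s) + volume.real (Set.Ioc s t) := by
      refine le_trans (measureReal_mono ?_) (measureReal_union_le _ _)
      rintro x ⟨hx, hxt⟩
      rcases le_or_gt x s with h | h
      · exact Or.inl ⟨hx, h⟩
      · exact Or.inr ⟨h, hxt⟩
    have h3 : volume.real (Set.Ioc s t) = (t : ℝ) - s := by
      rw [Measure.real, unitInterval.volume_Ioc, ENNReal.toReal_ofReal]
      have : (s : ℝ) ≤ t := hst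
      linarith
    rw [abs_of_nonneg (by linarith)]
    linarith
  have hcont : Continuous fun t : I => volume.real (S ∩ Set.Iic t) := by
    have : LipschitzWith 1 fun t : I => volume.real (S ∩ Set.Iic t) := by
      refine LipschitzWith.of_dist_le_mul fun s t => ?_
      rw [NNReal.coe_one, one_mul, Real.dist_eq, Subtype.dist_eq, Real.dist_eq]
      rcases le_total s t with h | h
      · rw [abs_sub_comm, abs_sub_comm (s : ℝ)]
        exact (key s t h).trans (le_abs_self _)
      · exact (key t s h).trans (le_abs_self _)
    exact this.continuous
  have hz : volume.real (S ∩ Set.Iic (0 : I)) = 0 := by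
    have : volume.real (Set.Iic (0 : I)) = 0 := by
      have : Set.Iic (0 : I) = {0} := Set.ext fun x =>
        ⟨fun h => le_antisymm h unitInterval.nonneg', fun h => (Set.mem_singleton_iff.1 h).le⟩
      simp [this, Measure.real]
    exact le_antisymm ((measureReal_mono Set.inter_subset_right).trans this.le) measureReal_nonneg
  have h1 : S ∩ Set.Iic (1 : I) = S := by
    ext x; simp [unitInterval.le_one']
  obtain ⟨t, -, ht⟩ := intermediate_value_Icc (zero_le_one (α := I)) hcont.continuousOn
    (show r ∈ Set.Icc _ _ by rw [hz, h1]; exact ⟨h0, hr⟩)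
  exact ⟨S ∩ Set.Iic t, Set.inter_subset_left, hS.inter measurableSet_Iic, ht⟩

theorem preimage_update_pi {ι β : Type*} [DecidableEq ι] (j : ι) (s : ι → Set β) :
    (fun z : (ι → β) × β => Function.update z.1 j z.2) ⁻¹' (Set.univ.pi s) =
      (Set.univ.pi (Function.update s j Set.univ)) ×ˢ s j := by
  ext z
  simp only [Set.mem_preimage, Set.mem_univ_pi, Set.mem_prod]
  constructor
  · intro h
    refine ⟨fun i => ?_, by simpa using h j⟩
    by_cases hi : i = j
    · subst hi; simp
    · simpa [hi] using h i
  · rintro ⟨h, h'⟩ i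
    by_cases hi : i = j
    · subst hi; simpa using h'
    · simpa [hi] using h i

/-- Resampling one coordinate of a uniformly random point of the cube gives a uniformly
random point. This is Fubini's theorem for that coordinate in a form that leaves the index type
of the cube unchanged. -/
theorem measurePreserving_update {ι : Type*} [Fintype ι] [DecidableEq ι] (j : ι) :
    MeasurePreserving (fun z : (ι → I) × I => Function.update z.1 j z.2) := by
  have hm : Measurable (fun z : (ι → I) × I => Function.update z.1 j z.2) := by
    refine measurable_pi_iff.2 fun i => ?_
    by_cases h : i = j
    · subst h; simpa using measurable_snd
    · simp only [Function.update_of_ne h]; fun_prop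
  refine ⟨hm, ?_⟩
  refine (Measure.pi_eq fun s hs => ?_).symm
  rw [Measure.map_apply hm (MeasurableSet.univ_pi hs)]
  rw [preimage_update_pi, Measure.volume_eq_prod, Measure.prod_prod, volume_pi_pi,
    ← Finset.prod_erase_mul _ _ (Finset.mem_univ j), ← Finset.prod_erase_mul _ _ (Finset.mem_univ j)]
  simp only [Function.update_self, measure_univ, mul_one]
  congr 1
  refine Finset.prod_congr rfl fun i hi => ?_
  rw [Function.update_of_ne (Finset.ne_of_mem_erase hi)]

/-- A density whose integrals over small disjoint sets of equal measure agree is constant. -/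
theorem exists_const_density {k : I → ℝ} (hk : Integrable k) {R : Set I} (hR : MeasurableSet R)
    {δ : ℝ} (hδ : 0 < δ)
    (h : ∀ B C, B ⊆ R → C ⊆ R → MeasurableSet B → MeasurableSet C → Disjoint B C →
      volume.real B = volume.real C → volume.real B ≤ δ → ∫ s in B, k s = ∫ s in C, k s) :
    ∃ κ : ℝ, ∀ B ⊆ R, MeasurableSet B → ∫ s in B, k s = κ * volume.real B := by
  rcases eq_or_ne (volume.real R) 0 with h0 | h0
  · refine ⟨0, fun B hB _ => ?_⟩
    have : volume B = 0 := measure_mono_null hB ((measureReal_eq_zero_iff).1 h0)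
    rw [setIntegral_measure_zero _ this, zero_mul]
  have hRpos : 0 < volume.real R := lt_of_le_of_ne measureReal_nonneg (Ne.symm h0)
  -- otherwise `k` equals its mean `κ` almost everywhere on `R`: where it is larger and where it is
  -- smaller there would be small sets of equal measure with different integrals
  set κ := (∫ s in R, k s) / volume.real R with hκ
  set g : I → ℝ := hk.1.mk k with hg
  have hkg : k =ᵐ[volume] g := hk.1.ae_eq_mk
  have hgm : Measurable g := hk.1.stronglyMeasurable_mk.measurable
  have hgi : Integrable g := hk.congr hkg
  have hint : ∀ B : Set I, ∫ s in B, k s = ∫ s in B, g s := fun B =>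
    integral_congr_ae (ae_restrict_of_ae hkg)
  have hconst : ∀ B : Set I, ∫ s in B, (g s - κ) = (∫ s in B, g s) - κ * volume.real B := by
    intro B
    rw [integral_sub hgi.integrableOn (integrable_const _)]
    simp [mul_comm]
  have hmean : ∫ s in R, (g s - κ) = 0 := by
    rw [hconst, ← hint, hκ]; field_simp; ring
  have hgi' : Integrable fun s => g s - κ := hgi.sub (integrable_const _)
  have hP : MeasurableSet (R ∩ {s | κ < g s}) := hR.inter (measurableSet_lt measurable_const hgm)
  have hN : MeasurableSet (R ∩ {s | g s < κ}) := hR.inter (measurableSet_lt hgm measurable_const)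
  have hor : volume.real (R ∩ {s | κ < g s}) = 0 ∨ volume.real (R ∩ {s | g s < κ}) = 0 := by
    by_contra hcon
    push Not at hcon
    have p1 := lt_of_le_of_ne measureReal_nonneg (Ne.symm hcon.1)
    have p2 := lt_of_le_of_ne measureReal_nonneg (Ne.symm hcon.2)
    set r := min δ (min (volume.real (R ∩ {s | κ < g s})) (volume.real (R ∩ {s | g s < κ})))
    have hr : 0 < r := lt_min hδ (lt_min p1 p2)
    obtain ⟨B, hB, hBm, hBr⟩ := exists_subset_measureReal_eq hP hr.le
      ((min_le_right _ _).trans (min_le_left _ _))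
    obtain ⟨C, hC, hCm, hCr⟩ := exists_subset_measureReal_eq hN hr.le
      ((min_le_right _ _).trans (min_le_right _ _))
    have hd : Disjoint B C := by
      rw [Set.disjoint_left]
      intro x hx hx'
      exact lt_asymm (show κ < g x from (hB hx).2) (hC hx').2
    have e := h B C (hB.trans Set.inter_subset_left) (hC.trans Set.inter_subset_left) hBm hCm hd
      (hBr.trans hCr.symm) (hBr.trans_le (min_le_left _ _))
    rw [hint, hint] at e
    have i1 : 0 < ∫ s in B, (g s - κ) := by
      rw [setIntegral_pos_iff_support_of_nonneg_ae]
      · have : Function.support (fun s => g s - κ) ∩ B = B := by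
          ext x
          simp only [Set.mem_inter_iff, Function.mem_support, and_iff_right_iff_imp]
          intro hx
          exact (sub_pos.2 (hB hx).2).ne'
        rw [this]
        refine pos_iff_ne_zero.2 fun h => ?_
        rw [Measure.real, h, ENNReal.toReal_zero] at hBr
        exact hr.ne hBr
      · exact (ae_restrict_iff' hBm).2 (Filter.Eventually.of_forall fun x hx =>
          (sub_pos.2 (hB hx).2).le)
      · exact hgi'.integrableOn
    have i2 : ∫ s in C, (g s - κ) ≤ 0 :=
      setIntegral_nonpos hCm fun x hx => (sub_neg.2 (hC hx).2).le
    rw [hconst] at i1 i2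
    rw [hBr] at i1
    rw [hCr] at i2
    linarith
  have hae : ∀ᵐ s ∂volume.restrict R, g s - κ = 0 := by
    rcases hor with h0 | h0
    · have hle : ∀ᵐ s ∂volume.restrict R, 0 ≤ -(g s - κ) := by
        rw [ae_restrict_iff' hR, ae_iff]
        refine measure_mono_null ?_ ((measureReal_eq_zero_iff).1 h0)
        intro x hx
        simp only [Set.mem_ofPred_eq, Classical.not_imp, not_le] at hx
        exact ⟨hx.1, by simpa using hx.2⟩
      have := (integral_eq_zero_iff_of_nonneg_ae hle hgi'.neg.integrableOn).1
        (by rw [integral_neg, hmean, neg_zero])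
      filter_upwards [this] with x hx
      exact neg_eq_zero.1 hx
    · have hle : ∀ᵐ s ∂volume.restrict R, 0 ≤ g s - κ := by
        rw [ae_restrict_iff' hR, ae_iff]
        refine measure_mono_null ?_ ((measureReal_eq_zero_iff).1 h0)
        intro x hx
        simp only [Set.mem_ofPred_eq, Classical.not_imp, not_le] at hx
        exact ⟨hx.1, by simpa using hx.2⟩
      exact (integral_eq_zero_iff_of_nonneg_ae hle hgi'.integrableOn).1 hmean
  refine ⟨κ, fun B hB _ => ?_⟩
  have : ∫ s in B, (g s - κ) = 0 := by
    rw [integral_congr_ae (ae_restrict_of_ae_restrict_of_subset hB hae), integral_zero]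
  rw [hint]
  linarith [hconst B]

/-! ### Quadratic forms that are constant on splits of a set -/

theorem sliceIntegral_nonneg {Ω : Type*} {φ : Ω → I → ℝ}
    (h01 : ∀ ω s, φ ω s ∈ Set.Icc (0 : ℝ) 1) (B : Set I) (ω : Ω) : 0 ≤ ∫ s in B, φ ω s :=
  integral_nonneg fun s => (h01 ω s).1

section Gram

variable {Ω : Type*} [MeasurableSpace Ω] {ρ : Measure Ω} {φ : Ω → I → ℝ}

theorem measurable_sliceIntegral (hφ : Measurable (Function.uncurry φ)) (B : Set I) :
    Measurable fun ω => ∫ s in B, φ ω s :=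
  (hφ.stronglyMeasurable.integral_prod_right (ν := volume.restrict B)).measurable

theorem integrable_slice (hφ : Measurable (Function.uncurry φ))
    (h01 : ∀ ω s, φ ω s ∈ Set.Icc (0 : ℝ) 1) (ω : Ω) : Integrable (φ ω) :=
  Integrable.of_bound (hφ.comp measurable_prodMk_left).aestronglyMeasurable 1
    (Filter.Eventually.of_forall fun s => by
      rw [Real.norm_eq_abs, abs_of_nonneg (h01 ω s).1]; exact (h01 ω s).2)

theorem sliceIntegral_le (hφ : Measurable (Function.uncurry φ))
    (h01 : ∀ ω s, φ ω s ∈ Set.Icc (0 : ℝ) 1) (B : Set I) (ω : Ω) :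
    ∫ s in B, φ ω s ≤ volume.real B := by
  calc ∫ s in B, φ ω s ≤ ∫ _ in B, (1 : ℝ) :=
        integral_mono (integrable_slice hφ h01 ω).integrableOn (integrable_const _)
          fun s => (h01 ω s).2
    _ = volume.real B := by simp

theorem sliceIntegral_union (hφ : Measurable (Function.uncurry φ))
    (h01 : ∀ ω s, φ ω s ∈ Set.Icc (0 : ℝ) 1) {B C : Set I} (hC : MeasurableSet C)
    (h : Disjoint B C) (ω : Ω) :
    ∫ s in B ∪ C, φ ω s = (∫ s in B, φ ω s) + ∫ s in C, φ ω s :=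
  setIntegral_union h hC (integrable_slice hφ h01 ω).integrableOn
    (integrable_slice hφ h01 ω).integrableOn

theorem integrable_sliceIntegral_mul [IsFiniteMeasure ρ] (hφ : Measurable (Function.uncurry φ))
    (h01 : ∀ ω s, φ ω s ∈ Set.Icc (0 : ℝ) 1) (B C : Set I) :
    Integrable (fun ω => (∫ s in B, φ ω s) * ∫ s in C, φ ω s) ρ := by
  refine Integrable.of_bound ((measurable_sliceIntegral hφ B).mul
    (measurable_sliceIntegral hφ C)).aestronglyMeasurable (volume.real B * volume.real C)
    (Filter.Eventually.of_forall fun ω => ?_)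
  rw [Real.norm_eq_abs, abs_mul, abs_of_nonneg (sliceIntegral_nonneg h01 B ω),
    abs_of_nonneg (sliceIntegral_nonneg h01 C ω)]
  exact mul_le_mul (sliceIntegral_le hφ h01 B ω) (sliceIntegral_le hφ h01 C ω)
    (sliceIntegral_nonneg h01 C ω) measureReal_nonneg

/-- The mixed second difference of the split functional vanishes: exchanging `B₁` with `C₁` and,
independently, `B₂` with `C₂` between the two parts of `D` gives four splits with the same
value. -/
theorem integral_sliceIntegral_sub_mul_sub_eq_zero [IsFiniteMeasure ρ]
    (hφ : Measurable (Function.uncurry φ))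
    (h01 : ∀ ω s, φ ω s ∈ Set.Icc (0 : ℝ) 1) {D : Set I} (hD : MeasurableSet D) {a a' c : ℝ}
    (hDa : volume.real D = a + a')
    (hsplit : ∀ A A' : Set I, MeasurableSet A → MeasurableSet A' → Disjoint A A' → A ∪ A' = D →
      volume.real A = a → volume.real A' = a' →
      ∫ ω, (∫ s in A, φ ω s) * (∫ s in A', φ ω s) ∂ρ = c)
    {B₁ C₁ B₂ C₂ : Set I} (mB₁ : MeasurableSet B₁) (mC₁ : MeasurableSet C₁)
    (mB₂ : MeasurableSet B₂) (mC₂ : MeasurableSet C₂)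
    (sB₁ : B₁ ⊆ D) (sC₁ : C₁ ⊆ D) (sB₂ : B₂ ⊆ D) (sC₂ : C₂ ⊆ D)
    (dB : Disjoint B₁ B₂) (dC : Disjoint C₁ C₂) (d₁ : Disjoint B₁ C₁) (d₂ : Disjoint B₂ C₂)
    (d₁₂ : Disjoint B₁ C₂) (d₂₁ : Disjoint B₂ C₁)
    (h₁ : volume.real B₁ = volume.real C₁) (h₂ : volume.real B₂ = volume.real C₂)
    (ha : volume.real B₁ + volume.real B₂ ≤ a) (ha' : volume.real B₁ + volume.real B₂ ≤ a') :
    ∫ ω, ((∫ s in B₁, φ ω s) - ∫ s in C₁, φ ω s) *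
      ((∫ s in B₂, φ ω s) - ∫ s in C₂, φ ω s) ∂ρ = 0 := by
  set U := (B₁ ∪ B₂) ∪ (C₁ ∪ C₂) with hU
  have mU : MeasurableSet U := (mB₁.union mB₂).union (mC₁.union mC₂)
  have sU : U ⊆ D := Set.union_subset (Set.union_subset sB₁ sB₂) (Set.union_subset sC₁ sC₂)
  have vU : volume.real U = 2 * (volume.real B₁ + volume.real B₂) := by
    rw [hU, measureReal_union (by
      simp only [Set.disjoint_union_left, Set.disjoint_union_right]; exact ⟨⟨d₁, d₂₁⟩, d₁₂, d₂⟩)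
      (mC₁.union mC₂), measureReal_union dB mB₂, measureReal_union dC mC₂, h₁, h₂]
    ring
  have vDU : volume.real (D \ U) = a + a' - 2 * (volume.real B₁ + volume.real B₂) := by
    rw [measureReal_sdiff sU mU, hDa, vU]
  obtain ⟨P, hP, mP, vP⟩ := exists_subset_measureReal_eq (hD.diff mU)
    (r := a - (volume.real B₁ + volume.real B₂)) (by linarith) (by linarith)
  set Q := (D \ U) \ P with hQ
  have mQ : MeasurableSet Q := (hD.diff mU).diff mP
  have vQ : volume.real Q = a' - (volume.real B₁ + volume.real B₂) := by
    rw [hQ, measureReal_sdiff hP mP, vDU, vP]; ring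
  have dPQ : Disjoint P Q := Set.disjoint_sdiff_right
  have PU : Disjoint P U := Set.disjoint_left.2 fun x hx => (hP hx).2
  have QU : Disjoint Q U := Set.disjoint_left.2 fun x hx => hx.1.2
  have hPQ : P ∪ Q = D \ U := Set.union_sdiff_cancel hP
  -- the split of `D` in which `X` and `Y` join the part `P` and `X'` and `Y'` join `Q`
  have four : ∀ X X' Y Y' : Set I, MeasurableSet X → MeasurableSet X' → MeasurableSet Y →
      MeasurableSet Y' → (X ∪ Y) ∪ (X' ∪ Y') = U → Disjoint X X' → Disjoint X Y →
      Disjoint X Y' → Disjoint X' Y → Disjoint X' Y' → Disjoint Y Y' →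
      volume.real X = volume.real B₁ → volume.real X' = volume.real B₁ →
      volume.real Y = volume.real B₂ → volume.real Y' = volume.real B₂ →
      ∫ ω, ((∫ s in P, φ ω s) + (∫ s in X, φ ω s) + ∫ s in Y, φ ω s) *
        ((∫ s in Q, φ ω s) + (∫ s in X', φ ω s) + ∫ s in Y', φ ω s) ∂ρ = c := by
    intro X X' Y Y' mX mX' mY mY' hXY dXX dXY dXY' dX'Y dX'Y' dYY vX vX' vY vY'
    rw [← hXY] at PU QU hPQ
    simp only [Set.disjoint_union_right] at PU QU
    have e : (P ∪ X ∪ Y) ∪ (Q ∪ X' ∪ Y') = D := by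
      have : (P ∪ X ∪ Y) ∪ (Q ∪ X' ∪ Y') = (P ∪ Q) ∪ ((X ∪ Y) ∪ (X' ∪ Y')) := by
        ext; simp only [Set.mem_union]; tauto
      rw [this, hPQ, hXY]; exact Set.sdiff_union_of_subset sU
    rw [← hsplit (P ∪ X ∪ Y) (Q ∪ X' ∪ Y') ((mP.union mX).union mY) ((mQ.union mX').union mY') ?_ e
      ?_ ?_]
    · refine integral_congr_ae (Filter.Eventually.of_forall fun ω => ?_)
      simp only
      rw [sliceIntegral_union hφ h01 mY (Set.disjoint_union_left.2 ⟨PU.1.2, dXY⟩),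
        sliceIntegral_union hφ h01 mX PU.1.1,
        sliceIntegral_union hφ h01 mY' (Set.disjoint_union_left.2 ⟨QU.2.2, dX'Y'⟩),
        sliceIntegral_union hφ h01 mX' QU.2.1]
    · simp only [Set.disjoint_union_left, Set.disjoint_union_right]
      exact ⟨⟨⟨⟨dPQ, QU.1.1.symm⟩, QU.1.2.symm⟩, ⟨PU.2.1, dXX⟩, dX'Y.symm⟩,
        ⟨PU.2.2, dXY'⟩, dYY⟩
    · rw [measureReal_union (Set.disjoint_union_left.2 ⟨PU.1.2, dXY⟩) mY,
        measureReal_union PU.1.1 mX, vP, vX, vY]; ring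
    · rw [measureReal_union (Set.disjoint_union_left.2 ⟨QU.2.2, dX'Y'⟩) mY',
        measureReal_union QU.2.1 mX', vQ, vX', vY']; ring
  have e₁ := four B₁ C₁ B₂ C₂ mB₁ mC₁ mB₂ mC₂ hU.symm d₁ dB d₁₂ d₂₁.symm dC d₂ rfl h₁.symm rfl
    h₂.symm
  have e₂ := four C₁ B₁ B₂ C₂ mC₁ mB₁ mB₂ mC₂ (by rw [hU]; ext; simp only [Set.mem_union]; tauto)
    d₁.symm d₂₁.symm dC dB d₁₂ d₂ h₁.symm rfl rfl h₂.symm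
  have e₃ := four B₁ C₁ C₂ B₂ mB₁ mC₁ mC₂ mB₂ (by rw [hU]; ext; simp only [Set.mem_union]; tauto)
    d₁ d₁₂ dB dC d₂₁.symm d₂.symm rfl h₁.symm h₂.symm rfl
  have e₄ := four C₁ B₁ C₂ B₂ mC₁ mB₁ mC₂ mB₂ (by rw [hU]; ext; simp only [Set.mem_union]; tauto)
    d₁.symm dC d₂₁.symm d₁₂ dB d₂.symm h₁.symm rfl h₂.symm rfl
  have hint : ∀ X Y X' Y' : Set I, Integrable (fun ω =>
      ((∫ s in P, φ ω s) + (∫ s in X, φ ω s) + ∫ s in Y, φ ω s) *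
        ((∫ s in Q, φ ω s) + (∫ s in X', φ ω s) + ∫ s in Y', φ ω s)) ρ := by
    intro X Y X' Y'
    have i := integrable_sliceIntegral_mul (ρ := ρ) hφ h01
    have := (((i P Q).add (i P X')).add (i P Y')).add ((((i X Q).add (i X X')).add (i X Y')).add
      (((i Y Q).add (i Y X')).add (i Y Y')))
    refine this.congr (Filter.Eventually.of_forall fun ω => ?_)
    simp only [Pi.add_apply]
    ring
  have key : ∫ ω, (-2 : ℝ) * (((∫ s in B₁, φ ω s) - ∫ s in C₁, φ ω s) *
      ((∫ s in B₂, φ ω s) - ∫ s in C₂, φ ω s)) ∂ρ = (c - c) - (c - c) := by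
    have comb : ∀ f g h k : Ω → ℝ, Integrable f ρ → Integrable g ρ → Integrable h ρ →
        Integrable k ρ → ∫ ω, ((f ω - g ω) - (h ω - k ω)) ∂ρ =
          ((∫ ω, f ω ∂ρ) - ∫ ω, g ω ∂ρ) - ((∫ ω, h ω ∂ρ) - ∫ ω, k ω ∂ρ) := by
      intro f g h k hf hg hh hk
      rw [integral_sub (f := fun ω => f ω - g ω) (g := fun ω => h ω - k ω) (hf.sub hg)
        (hh.sub hk), integral_sub hf hg, integral_sub hh hk]
    have e := comb _ _ _ _ (hint B₁ B₂ C₁ C₂) (hint C₁ B₂ B₁ C₂) (hint B₁ C₂ C₁ B₂)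
      (hint C₁ C₂ B₁ B₂)
    rw [e₁, e₂, e₃, e₄] at e
    rw [← e]
    refine integral_congr_ae (Filter.Eventually.of_forall fun ω => ?_)
    simp only
    ring
  rw [integral_const_mul] at key
  linarith

/-- If the Gram functional `(A, A') ↦ ∫ (∫_A φ) (∫_{A'} φ)` takes the same value at all splits
`D = A ⊔ A'` into parts of given measures, then `φ` has, for almost every parameter, the same
integral over any two small disjoint subsets of `D` of equal measure. The quadratic form is
additive along a partition of the pair `(B, C)` into smaller pairs, by the vanishing of the mixed
differences, while it is of second order in the measure of a pair; repeated halving makes it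
vanish. -/
theorem ae_sliceIntegral_eq [IsFiniteMeasure ρ]
    (hφ : Measurable (Function.uncurry φ))
    (h01 : ∀ ω s, φ ω s ∈ Set.Icc (0 : ℝ) 1) {D : Set I} (hD : MeasurableSet D) {a a' c : ℝ}
    (hDa : volume.real D = a + a')
    (hsplit : ∀ A A' : Set I, MeasurableSet A → MeasurableSet A' → Disjoint A A' → A ∪ A' = D →
      volume.real A = a → volume.real A' = a' →
      ∫ ω, (∫ s in A, φ ω s) * (∫ s in A', φ ω s) ∂ρ = c)
    {B C : Set I} (mB : MeasurableSet B) (mC : MeasurableSet C) (sB : B ⊆ D) (sC : C ⊆ D)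
    (d : Disjoint B C) (hBC : volume.real B = volume.real C)
    (ha : volume.real B ≤ a) (ha' : volume.real B ≤ a') :
    ∀ᵐ ω ∂ρ, ∫ s in B, φ ω s = ∫ s in C, φ ω s := by
  have i := integrable_sliceIntegral_mul (ρ := ρ) hφ h01
  have i4 : ∀ B C B' C' : Set I, Integrable (fun ω => ((∫ s in B, φ ω s) - ∫ s in C, φ ω s) *
      ((∫ s in B', φ ω s) - ∫ s in C', φ ω s)) ρ := by
    intro B C B' C'
    refine (((i B B').sub (i B C')).sub ((i C B').sub (i C C'))).congr
      (Filter.Eventually.of_forall fun ω => ?_)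
    simp only [Pi.sub_apply]
    ring
  have halving : ∀ k : ℕ, ∀ B C : Set I, MeasurableSet B → MeasurableSet C → B ⊆ D → C ⊆ D →
      Disjoint B C → volume.real B = volume.real C → volume.real B ≤ a → volume.real B ≤ a' →
      ∫ ω, ((∫ s in B, φ ω s) - ∫ s in C, φ ω s) * ((∫ s in B, φ ω s) - ∫ s in C, φ ω s) ∂ρ
        ≤ volume.real B ^ 2 * ρ.real Set.univ / 2 ^ k := by
    intro k
    induction k with
    | zero =>
      intro B C mB mC sB sC d hBC ha ha'
      calc _ ≤ ∫ _, volume.real B ^ 2 ∂ρ := by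
            refine integral_mono (i4 _ _ _ _) (integrable_const _) fun ω => ?_
            simp only
            have b0 := sliceIntegral_nonneg h01 B ω
            have c0 := sliceIntegral_nonneg h01 C ω
            have b1 := sliceIntegral_le hφ h01 B ω
            have c1 := sliceIntegral_le hφ h01 C ω
            rw [← sq]
            refine sq_le_sq' ?_ ?_ <;> linarith
        _ = _ := by simp [mul_comm]
    | succ k ih =>
      intro B C mB mC sB sC d hBC ha ha'
      have hB0 : 0 ≤ volume.real B := measureReal_nonneg
      obtain ⟨B₁, hB₁, mB₁, vB₁⟩ := exists_subset_measureReal_eq mB (r := volume.real B / 2)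
        (by linarith) (by linarith)
      obtain ⟨C₁, hC₁, mC₁, vC₁⟩ := exists_subset_measureReal_eq mC (r := volume.real B / 2)
        (by linarith) (by linarith)
      have vB₂ : volume.real (B \ B₁) = volume.real B / 2 := by
        rw [measureReal_sdiff hB₁ mB₁, vB₁]; ring
      have vC₂ : volume.real (C \ C₁) = volume.real B / 2 := by
        rw [measureReal_sdiff hC₁ mC₁, vC₁, ← hBC]; ring
      have cross := integral_sliceIntegral_sub_mul_sub_eq_zero hφ h01 hD hDa hsplit mB₁ mC₁
        (mB.diff mB₁) (mC.diff mC₁) (hB₁.trans sB) (hC₁.trans sC) (Set.sdiff_subset.trans sB)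
        (Set.sdiff_subset.trans sC) Set.disjoint_sdiff_right Set.disjoint_sdiff_right
        (d.mono hB₁ hC₁) (d.mono Set.sdiff_subset Set.sdiff_subset) (d.mono hB₁ Set.sdiff_subset)
        (d.mono Set.sdiff_subset hC₁) (vB₁.trans vC₁.symm) (vB₂.trans vC₂.symm)
        (by rw [vB₁, vB₂]; linarith) (by rw [vB₁, vB₂]; linarith)
      have q₁ := ih B₁ C₁ mB₁ mC₁ (hB₁.trans sB) (hC₁.trans sC) (d.mono hB₁ hC₁)
        (vB₁.trans vC₁.symm) (by linarith) (by linarith)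
      have q₂ := ih (B \ B₁) (C \ C₁) (mB.diff mB₁) (mC.diff mC₁) (Set.sdiff_subset.trans sB)
        (Set.sdiff_subset.trans sC) (d.mono Set.sdiff_subset Set.sdiff_subset)
        (vB₂.trans vC₂.symm) (by linarith) (by linarith)
      have sumB : ∀ ω, ∫ s in B, φ ω s = (∫ s in B₁, φ ω s) + ∫ s in B \ B₁, φ ω s := by
        intro ω
        rw [← sliceIntegral_union hφ h01 (mB.diff mB₁) Set.disjoint_sdiff_right,
          Set.union_sdiff_cancel hB₁]
      have sumC : ∀ ω, ∫ s in C, φ ω s = (∫ s in C₁, φ ω s) + ∫ s in C \ C₁, φ ω s := by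
        intro ω
        rw [← sliceIntegral_union hφ h01 (mC.diff mC₁) Set.disjoint_sdiff_right,
          Set.union_sdiff_cancel hC₁]
      have expand : ∫ ω, ((∫ s in B, φ ω s) - ∫ s in C, φ ω s) *
          ((∫ s in B, φ ω s) - ∫ s in C, φ ω s) ∂ρ =
          ((∫ ω, ((∫ s in B₁, φ ω s) - ∫ s in C₁, φ ω s) *
            ((∫ s in B₁, φ ω s) - ∫ s in C₁, φ ω s) ∂ρ) +
          (∫ ω, ((∫ s in B \ B₁, φ ω s) - ∫ s in C \ C₁, φ ω s) *
            ((∫ s in B \ B₁, φ ω s) - ∫ s in C \ C₁, φ ω s) ∂ρ)) +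
          2 * ∫ ω, ((∫ s in B₁, φ ω s) - ∫ s in C₁, φ ω s) *
            ((∫ s in B \ B₁, φ ω s) - ∫ s in C \ C₁, φ ω s) ∂ρ := by
        rw [← integral_const_mul, ← integral_add (i4 _ _ _ _) (i4 _ _ _ _),
          ← integral_add ((i4 _ _ _ _).fun_add (i4 _ _ _ _)) ((i4 _ _ _ _).const_mul 2)]
        refine integral_congr_ae (Filter.Eventually.of_forall fun ω => ?_)
        simp only [sumB ω, sumC ω]
        ring
      rw [expand, cross]
      rw [vB₁] at q₁
      rw [vB₂] at q₂
      have : volume.real B ^ 2 * ρ.real Set.univ / 2 ^ (k + 1) =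
        (volume.real B / 2) ^ 2 * ρ.real Set.univ / 2 ^ k +
          (volume.real B / 2) ^ 2 * ρ.real Set.univ / 2 ^ k := by
        rw [pow_succ]; field_simp; ring
      linarith
  have nn : ∀ ω, 0 ≤ ((∫ s in B, φ ω s) - ∫ s in C, φ ω s) *
      ((∫ s in B, φ ω s) - ∫ s in C, φ ω s) := fun ω => mul_self_nonneg _
  have zero : ∫ ω, ((∫ s in B, φ ω s) - ∫ s in C, φ ω s) *
      ((∫ s in B, φ ω s) - ∫ s in C, φ ω s) ∂ρ = 0 := by
    refine le_antisymm ?_ (integral_nonneg nn)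
    have lim : Filter.Tendsto (fun k : ℕ => volume.real B ^ 2 * ρ.real Set.univ / 2 ^ k)
        Filter.atTop (nhds 0) :=
      tendsto_const_nhds.div_atTop (tendsto_pow_atTop_atTop_of_one_lt one_lt_two)
    exact ge_of_tendsto' lim fun k => halving k B C mB mC sB sC d hBC ha ha'
  filter_upwards [(integral_eq_zero_iff_of_nonneg nn (i4 _ _ _ _)).1 zero] with ω hω
  exact sub_eq_zero.1 (mul_self_eq_zero.1 hω)

end Gram

/-! ### Box integrals and exchange in one side -/

theorem measurableSet_update {ι : Type*} [DecidableEq ι] {A : ι → Set I}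
    (hA : ∀ i, MeasurableSet (A i)) (j : ι) {B : Set I}
    (hB : MeasurableSet B) (i : ι) : MeasurableSet (Function.update A j B i) := by
  by_cases h : i = j
  · subst h; simpa using hB
  · simpa [h] using hA i

theorem disjoint_update {ι : Type*} [DecidableEq ι] {A : ι → Set I} {j : ι} {B : Set I}
    (hA : ∀ i k, i ≠ k → Disjoint (A i) (A k)) (hB : ∀ i, i ≠ j → Disjoint B (A i))
    (i k : ι) (hik : i ≠ k) :
    Disjoint (Function.update A j B i) (Function.update A j B k) := by
  by_cases hi : i = j
  · subst hi; simpa [hik.symm] using hB k hik.symm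
  · by_cases hk : k = j
    · subst hk; simpa [hi] using (hB i hi).symm
    · simpa [hi, hk] using hA i k hik

section Boxes

variable {ι : Type*} [Fintype ι] [DecidableEq ι]

theorem prod_measureReal_update (A : ι → Set I) (j : ι) (B : Set I) :
    ∏ i, volume.real (Function.update A j B i) =
      volume.real B * ∏ i ∈ Finset.univ.erase j, volume.real (A i) := by
  rw [← Finset.mul_prod_erase _ _ (Finset.mem_univ j), Function.update_self]
  congr 1
  refine Finset.prod_congr rfl fun i hi => ?_
  rw [Function.update_of_ne (Finset.ne_of_mem_erase hi)]

theorem measureReal_compl_biUnion_erase {A : ι → Set I} (mA : ∀ i, MeasurableSet (A i))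
    (dA : ∀ i k, i ≠ k → Disjoint (A i) (A k)) (j : ι) :
    volume.real (⋃ i ∈ Finset.univ.erase j, A i)ᶜ =
      1 - ∑ i ∈ Finset.univ.erase j, volume.real (A i) := by
  rw [probReal_compl_eq_one_sub (Finset.measurableSet_biUnion _ fun i _ => mA i),
    measureReal_biUnion_finset (fun i _ k _ h => dA i k h) fun i _ => mA i]

theorem disjoint_of_subset_compl_biUnion_erase {A : ι → Set I} {j : ι} {B : Set I}
    (hB : B ⊆ (⋃ i ∈ Finset.univ.erase j, A i)ᶜ) (i : ι) (hi : i ≠ j) : Disjoint B (A i) := by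
  refine Set.disjoint_left.2 fun x hx hxi => hB hx ?_
  simp only [Set.mem_iUnion]
  exact ⟨i, Finset.mem_erase.2 ⟨hi, Finset.mem_univ i⟩, hxi⟩

variable {f : (ι → I) → ℝ}

theorem integrable_of_mem_Icc {X : Type*} [MeasurableSpace X] {μ : Measure X} [IsFiniteMeasure μ]
    {g : X → ℝ} (hg : Measurable g) (h01 : ∀ x, g x ∈ Set.Icc (0 : ℝ) 1) : Integrable g μ :=
  Integrable.of_bound hg.aestronglyMeasurable 1 (Filter.Eventually.of_forall fun s => by
    rw [Real.norm_eq_abs, abs_of_nonneg (h01 s).1]; exact (h01 s).2)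

/-- Fubini's theorem for one side of a box: as a function of that side, the integral over the
box has a density. -/
theorem setIntegral_pi_update (hf : Measurable f) (h01 : ∀ x, f x ∈ Set.Icc (0 : ℝ) 1)
    {A : ι → Set I} (mA : ∀ i, MeasurableSet (A i)) (j : ι) {B : Set I} (mB : MeasurableSet B) :
    ∫ x in Set.univ.pi (Function.update A j B), f x =
      ∫ s in B, ∫ x in Set.univ.pi (Function.update A j Set.univ), f (Function.update x j s) := by
  have mp := measurePreserving_update (ι := ι) j
  conv_lhs => rw [← mp.map_eq]
  rw [setIntegral_map (MeasurableSet.univ_pi (measurableSet_update mA j mB))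
    hf.aestronglyMeasurable mp.aemeasurable, preimage_update_pi, Function.update_idem,
    Function.update_self, Measure.volume_eq_prod, ← setIntegral_prod_swap, setIntegral_prod]
  · simp
  · exact (integrable_of_mem_Icc ((hf.comp mp.measurable).comp measurable_swap)
      fun z => h01 _).integrableOn

theorem integrable_boxDensity (hf : Measurable f) (h01 : ∀ x, f x ∈ Set.Icc (0 : ℝ) 1)
    (S : Set (ι → I)) (j : ι) :
    Integrable fun s => ∫ x in S, f (Function.update x j s) := by
  have mp := measurePreserving_update (ι := ι) j
  have : Integrable (fun z : I × (ι → I) => f (Function.update z.2 j z.1))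
      ((volume : Measure I).prod (volume.restrict S)) :=
    integrable_of_mem_Icc ((hf.comp mp.measurable).comp measurable_swap) fun z => h01 _
  exact this.integral_prod_left

/-- Fubini's theorem for two sides of a box, for an integrand that is the product of a factor
depending on the first side and the same factor evaluated at the second. -/
theorem setIntegral_pi_update_update (hf : Measurable f)
    {u v : ι} (huv : u ≠ v) {φ : (ι → I) → I → ℝ} (hφ : Measurable (Function.uncurry φ))
    (hφ01 : ∀ x s, φ x s ∈ Set.Icc (0 : ℝ) 1)
    (hfφ : ∀ x s t, f (Function.update (Function.update x u s) v t) = φ x s * φ x t)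
    {A : ι → Set I} (mA : ∀ i, MeasurableSet (A i)) {B C : Set I} (mB : MeasurableSet B)
    (mC : MeasurableSet C) :
    ∫ x in Set.univ.pi (Function.update (Function.update A u B) v C), f x =
      ∫ x in Set.univ.pi (Function.update (Function.update A u Set.univ) v Set.univ),
        (∫ s in B, φ x s) * ∫ t in C, φ x t := by
  have mp : MeasurePreserving (fun z : (ι → I) × (I × I) =>
      Function.update (Function.update z.1 u z.2.1) v z.2.2) :=
    (measurePreserving_update v).comp (((measurePreserving_update u).prod
      (MeasurePreserving.id (volume : Measure I))).comp
        (measurePreserving_prodAssoc (volume : Measure (ι → I)) (volume : Measure I)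
          (volume : Measure I)).symm)
  conv_lhs => rw [← mp.map_eq]
  have pre : (fun z : (ι → I) × (I × I) =>
      Function.update (Function.update z.1 u z.2.1) v z.2.2) ⁻¹'
        (Set.univ.pi (Function.update (Function.update A u B) v C)) =
      (Set.univ.pi (Function.update (Function.update A u Set.univ) v Set.univ)) ×ˢ (B ×ˢ C) := by
    ext z
    have e1 := Set.ext_iff.1 (preimage_update_pi v (Function.update (Function.update A u B) v C))
      (Function.update z.1 u z.2.1, z.2.2)
    have e2 := Set.ext_iff.1 (preimage_update_pi u
      (Function.update (Function.update A v Set.univ) u B)) (z.1, z.2.1)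
    simp only [Set.mem_preimage, Set.mem_prod, Function.update_idem, Function.update_self]
      at e1 e2 ⊢
    rw [Function.update_comm huv B Set.univ A] at e1
    rw [e1, e2, and_assoc, Function.update_comm huv Set.univ Set.univ A]
  rw [setIntegral_map (MeasurableSet.univ_pi (measurableSet_update (measurableSet_update mA u mB)
    v mC)) hf.aestronglyMeasurable mp.aemeasurable, pre, Measure.volume_eq_prod,
    setIntegral_prod]
  · refine integral_congr_ae (Filter.Eventually.of_forall fun x => ?_)
    simp only [hfφ]
    rw [Measure.volume_eq_prod, setIntegral_prod_mul]
  · simp only [hfφ]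
    refine (integrable_of_mem_Icc ?_ fun z => ⟨mul_nonneg (hφ01 _ _).1 (hφ01 _ _).1,
      mul_le_one₀ (hφ01 _ _).2 (hφ01 _ _).1 (hφ01 _ _).2⟩).integrableOn
    exact (hφ.comp (measurable_fst.prodMk measurable_snd.fst)).mul
      (hφ.comp (measurable_fst.prodMk measurable_snd.snd))

/-- The box integral is proportional to the measure of the `j`-th side as soon as exchanging
small subsets of `R` of equal measure in that side does not change it; one side `B₀ ⊆ R` with the
expected value then determines the factor. -/
theorem setIntegral_pi_of_exchange (hf : Measurable f) (h01 : ∀ x, f x ∈ Set.Icc (0 : ℝ) 1)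
    {A : ι → Set I} (mA : ∀ i, MeasurableSet (A i)) {j : ι} {R : Set I} (mR : MeasurableSet R)
    (hAR : A j ⊆ R) {δ : ℝ} (hδ : 0 < δ)
    (h : ∀ B C, B ⊆ R → C ⊆ R → MeasurableSet B → MeasurableSet C → Disjoint B C →
      volume.real B = volume.real C → volume.real B ≤ δ →
      ∫ x in Set.univ.pi (Function.update A j B), f x =
        ∫ x in Set.univ.pi (Function.update A j C), f x)
    {c : ℝ} {B₀ : Set I} (mB₀ : MeasurableSet B₀) (hB₀ : B₀ ⊆ R) (pB₀ : 0 < volume.real B₀)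
    (h₀ : ∫ x in Set.univ.pi (Function.update A j B₀), f x =
      c * ∏ i, volume.real (Function.update A j B₀ i)) :
    ∫ x in Set.univ.pi A, f x = c * ∏ i, volume.real (A i) := by
  obtain ⟨κ, hκ⟩ := exists_const_density
    (integrable_boxDensity hf h01 (Set.univ.pi (Function.update A j Set.univ)) j) mR hδ
    (fun B C sB sC mB mC d e l => by
      rw [← setIntegral_pi_update hf h01 mA j mB, ← setIntegral_pi_update hf h01 mA j mC]
      exact h B C sB sC mB mC d e l)
  rw [prod_measureReal_update, setIntegral_pi_update hf h01 mA j mB₀, hκ B₀ hB₀ mB₀] at h₀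
  have hκ' : κ = c * ∏ i ∈ Finset.univ.erase j, volume.real (A i) := by
    refine mul_right_cancel₀ pB₀.ne' ?_
    rw [h₀]; ring
  calc ∫ x in Set.univ.pi A, f x = ∫ x in Set.univ.pi (Function.update A j (A j)), f x := by
        rw [Function.update_eq_self]
    _ = κ * volume.real (A j) := by
        rw [setIntegral_pi_update hf h01 mA j (mA j), hκ _ hAR (mA j)]
    _ = _ := by
        rw [hκ', ← Finset.mul_prod_erase _ _ (Finset.mem_univ j)]; ring

/-- If there is room outside the other sides for more than `a`, then knowing the box integral
for all `j`-th sides of measure `a` determines it for all smaller ones. -/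
theorem setIntegral_pi_of_room (hf : Measurable f) (h01 : ∀ x, f x ∈ Set.Icc (0 : ℝ) 1)
    {A : ι → Set I} (mA : ∀ i, MeasurableSet (A i)) (dA : ∀ i k, i ≠ k → Disjoint (A i) (A k))
    {j : ι} {a : ℝ} (ha : 0 < a)
    (hroom : a < volume.real (⋃ i ∈ Finset.univ.erase j, A i)ᶜ) {c : ℝ}
    (h : ∀ B, MeasurableSet B → (∀ i, i ≠ j → Disjoint B (A i)) → volume.real B = a →
      ∫ x in Set.univ.pi (Function.update A j B), f x =
        c * ∏ i, volume.real (Function.update A j B i)) :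
    ∫ x in Set.univ.pi A, f x = c * ∏ i, volume.real (A i) := by
  set R := (⋃ i ∈ Finset.univ.erase j, A i)ᶜ with hR
  have mR : MeasurableSet R := (Finset.measurableSet_biUnion _ fun i _ => mA i).compl
  have hAR : A j ⊆ R := by
    intro x hx hx'
    simp only [Set.mem_iUnion] at hx'
    obtain ⟨i, hi, hxi⟩ := hx'
    exact Set.disjoint_left.1 (dA j i (Finset.ne_of_mem_erase hi).symm) hx hxi
  obtain ⟨B₀, sB₀, mB₀, vB₀⟩ := exists_subset_measureReal_eq mR ha.le hroom.le
  -- sets `B`, `C` to be exchanged are completed by the same `X` to sides of measure `a`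
  refine setIntegral_pi_of_exchange hf h01 mA mR hAR
    (δ := min a (volume.real R - a)) (lt_min ha (sub_pos.2 hroom)) ?_ mB₀ sB₀ (vB₀ ▸ ha)
    (h B₀ mB₀ (disjoint_of_subset_compl_biUnion_erase sB₀) vB₀)
  intro B C sB sC mB mC d e l
  have l1 := l.trans (min_le_left _ _)
  have l2 := l.trans (min_le_right _ _)
  have vR : volume.real (R \ (B ∪ C)) = volume.real R - 2 * volume.real B := by
    rw [measureReal_sdiff (Set.union_subset sB sC) (mB.union mC), measureReal_union d mC, ← e]
    ring
  obtain ⟨X, sX, mX, vX⟩ := exists_subset_measureReal_eq (mR.diff (mB.union mC))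
    (r := a - volume.real B) (by linarith) (by linarith)
  have dBX : Disjoint B X := Set.disjoint_left.2 fun x hx hx' => (sX hx').2 (Or.inl hx)
  have dCX : Disjoint C X := Set.disjoint_left.2 fun x hx hx' => (sX hx').2 (Or.inr hx)
  have sXR : X ⊆ R := sX.trans Set.sdiff_subset
  have add : ∀ Y, MeasurableSet Y → Disjoint Y X →
      ∫ x in Set.univ.pi (Function.update A j (Y ∪ X)), f x =
        (∫ x in Set.univ.pi (Function.update A j Y), f x) +
          ∫ x in Set.univ.pi (Function.update A j X), f x := by
    intro Y mY dY
    have i := integrable_boxDensity hf h01 (Set.univ.pi (Function.update A j Set.univ)) j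
    rw [setIntegral_pi_update hf h01 mA j (mY.union mX), setIntegral_pi_update hf h01 mA j mY,
      setIntegral_pi_update hf h01 mA j mX, setIntegral_union dY mX i.integrableOn i.integrableOn]
  have vBX : volume.real (B ∪ X) = a := by rw [measureReal_union dBX mX, vX]; ring
  have vCX : volume.real (C ∪ X) = a := by rw [measureReal_union dCX mX, vX, ← e]; ring
  have hB := h (B ∪ X) (mB.union mX)
    (disjoint_of_subset_compl_biUnion_erase (Set.union_subset sB sXR)) vBX
  have hC := h (C ∪ X) (mC.union mX)
    (disjoint_of_subset_compl_biUnion_erase (Set.union_subset sC sXR)) vCX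
  rw [add B mB dBX, prod_measureReal_update, vBX] at hB
  rw [add C mC dCX, prod_measureReal_update, vCX] at hC
  linarith

end Boxes

/-! ### Shrinking the sides of a box -/

section Twins

variable {ι : Type*} [Fintype ι] [DecidableEq ι] {f : (ι → I) → ℝ}

/-- The twin coordinates `u` and `v` make the side `u` free to shrink, even if the sides of the
given measures fill the whole interval. -/
theorem setIntegral_pi_of_lt_of_twins (hf : Measurable f) (h01 : ∀ x, f x ∈ Set.Icc (0 : ℝ) 1)
    {u v : ι} (huv : u ≠ v) {φ : (ι → I) → I → ℝ} (hφ : Measurable (Function.uncurry φ))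
    (hφ01 : ∀ x s, φ x s ∈ Set.Icc (0 : ℝ) 1)
    (hfφ : ∀ x s t, f (Function.update (Function.update x u s) v t) = φ x s * φ x t)
    {α : ι → ℝ} (hα : ∀ i, 0 < α i) (hsum : ∑ i, α i ≤ 1) {c : ℝ}
    (H : ∀ A : ι → Set I, (∀ i, MeasurableSet (A i)) → (∀ i k, i ≠ k → Disjoint (A i) (A k)) →
      (∀ i, volume.real (A i) = α i) → ∫ x in Set.univ.pi A, f x = c * ∏ i, volume.real (A i))
    {A : ι → Set I} (mA : ∀ i, MeasurableSet (A i)) (dA : ∀ i k, i ≠ k → Disjoint (A i) (A k))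
    (hu : volume.real (A u) < α u) (hA : ∀ i, i ≠ u → volume.real (A i) = α i) :
    ∫ x in Set.univ.pi A, f x = c * ∏ i, volume.real (A i) := by
  -- enlarge the side `u` to a set `E` of the full measure `α u`
  set R := (⋃ i ∈ Finset.univ.erase u, A i)ᶜ with hR
  have mR : MeasurableSet R := (Finset.measurableSet_biUnion _ fun i _ => mA i).compl
  have hAR : A u ⊆ R := by
    intro x hx hx'
    simp only [Set.mem_iUnion] at hx'
    obtain ⟨i, hi, hxi⟩ := hx'
    exact Set.disjoint_left.1 (dA u i (Finset.ne_of_mem_erase hi).symm) hx hxi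
  have vR : α u ≤ volume.real R := by
    rw [hR, measureReal_compl_biUnion_erase mA dA,
      Finset.sum_congr rfl fun i hi => hA i (Finset.ne_of_mem_erase hi)]
    have := Finset.add_sum_erase Finset.univ α (Finset.mem_univ u)
    linarith
  obtain ⟨X, sX, mX, vX⟩ := exists_subset_measureReal_eq (mR.diff (mA u))
    (r := α u - volume.real (A u)) (by linarith)
    (by rw [measureReal_sdiff hAR (mA u)]; linarith)
  set E := A u ∪ X with hE
  have mE : MeasurableSet E := (mA u).union mX
  have vE : volume.real E = α u := by
    rw [hE, measureReal_union (Set.disjoint_left.2 fun x hx hx' => (sX hx').2 hx) mX, vX]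
    ring
  have dE : ∀ i, i ≠ u → Disjoint E (A i) := disjoint_of_subset_compl_biUnion_erase
    (Set.union_subset hAR (sX.trans Set.sdiff_subset))
  set D := E ∪ A v with hD
  have mD : MeasurableSet D := mE.union (mA v)
  have vD : volume.real D = α u + α v := by
    rw [hD, measureReal_union (dE v huv.symm) (mA v), vE, hA v huv.symm]
  have dD : ∀ i, i ≠ u → i ≠ v → Disjoint D (A i) := fun i h h' =>
    Set.disjoint_union_left.2 ⟨dE i h, dA v i h'.symm⟩
  have hsplit : ∀ P Q : Set I, MeasurableSet P → MeasurableSet Q → Disjoint P Q → P ∪ Q = D →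
      volume.real P = α u → volume.real Q = α v →
      ∫ x in Set.univ.pi (Function.update (Function.update A u Set.univ) v Set.univ),
        (∫ s in P, φ x s) * (∫ s in Q, φ x s) = c * ∏ i, α i := by
    intro P Q mP mQ dPQ hPQ vP vQ
    have key : ∀ i, i ≠ u → i ≠ v → Disjoint P (A i) ∧ Disjoint Q (A i) := fun i h h' => by
      have := dD i h h'
      rw [← hPQ] at this
      exact Set.disjoint_union_left.1 this
    have vA : ∀ i, volume.real (Function.update (Function.update A u P) v Q i) = α i := by
      intro i
      by_cases hv : i = v
      · subst hv; simpa using vQ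
      by_cases hu : i = u
      · subst hu; simpa [hv] using vP
      · simpa [hv, hu] using hA i hu
    rw [← setIntegral_pi_update_update hf huv hφ hφ01 hfφ mA mP mQ,
      H _ (measurableSet_update (measurableSet_update mA u mP) v mQ) ?_ vA]
    · simp only [vA]
    · intro i k hik
      by_cases hiv : i = v
      · subst hiv
        by_cases hku : k = u
        · subst hku; simpa [hik.symm] using dPQ.symm
        · simpa [hik.symm, hku] using (key k hku hik.symm).2
      by_cases hkv : k = v
      · subst hkv
        by_cases hiu : i = u
        · subst hiu; simpa [hik] using dPQ
        · simpa [hik, hiu] using (key i hiu hik).2.symm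
      by_cases hiu : i = u
      · subst hiu; simpa [hik.symm, hiv, hkv] using (key k hik.symm hkv).1
      by_cases hku : k = u
      · subst hku; simpa [hik, hiv, hkv] using (key i hik hiv).1.symm
      · simpa [hiv, hkv, hiu, hku] using dA i k hik
  refine setIntegral_pi_of_exchange hf h01 mA mD (Set.subset_union_left.trans
    Set.subset_union_left) (δ := min (α u) (α v)) (lt_min (hα u) (hα v)) ?_ mE
    Set.subset_union_left (vE ▸ hα u)
    (H _ (measurableSet_update mA u mE) (disjoint_update dA dE) fun i => ?_)
  · intro B C sB sC mB mC d e l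
    have hv : ∀ Y : Set I, Function.update (Function.update A u Y) v (A v) =
        Function.update A u Y := fun Y => by
      rw [Function.update_eq_self_iff, Function.update_of_ne huv.symm]
    rw [← hv B, ← hv C, setIntegral_pi_update_update hf huv hφ hφ01 hfφ mA mB (mA v),
      setIntegral_pi_update_update hf huv hφ hφ01 hfφ mA mC (mA v)]
    refine integral_congr_ae ?_
    filter_upwards [ae_sliceIntegral_eq hφ hφ01 mD vD hsplit mB mC sB sC d e
      (l.trans (min_le_left _ _)) (l.trans (min_le_right _ _))] with x hx
    rw [hx]
  · by_cases hi : i = u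
    · subst hi; simpa using vE
    · simpa [hi] using hA i hi

/-- All sides may shrink: once one side is strictly shorter than prescribed there is room
for the exchange argument in every other side. -/
theorem setIntegral_pi_of_forall_lt (hf : Measurable f) (h01 : ∀ x, f x ∈ Set.Icc (0 : ℝ) 1)
    {u v : ι} (huv : u ≠ v) {φ : (ι → I) → I → ℝ} (hφ : Measurable (Function.uncurry φ))
    (hφ01 : ∀ x s, φ x s ∈ Set.Icc (0 : ℝ) 1)
    (hfφ : ∀ x s t, f (Function.update (Function.update x u s) v t) = φ x s * φ x t)
    {α : ι → ℝ} (hα : ∀ i, 0 < α i) (hsum : ∑ i, α i ≤ 1) {c : ℝ}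
    (H : ∀ A : ι → Set I, (∀ i, MeasurableSet (A i)) → (∀ i k, i ≠ k → Disjoint (A i) (A k)) →
      (∀ i, volume.real (A i) = α i) → ∫ x in Set.univ.pi A, f x = c * ∏ i, volume.real (A i))
    {A : ι → Set I} (mA : ∀ i, MeasurableSet (A i)) (dA : ∀ i k, i ≠ k → Disjoint (A i) (A k))
    (hA : ∀ i, volume.real (A i) < α i) :
    ∫ x in Set.univ.pi A, f x = c * ∏ i, volume.real (A i) := by
  have main : ∀ S : Finset ι, ∀ A : ι → Set I, (∀ i, MeasurableSet (A i)) →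
      (∀ i k, i ≠ k → Disjoint (A i) (A k)) → volume.real (A u) < α u →
      (∀ i ∈ S, volume.real (A i) < α i) → (∀ i, i ≠ u → i ∉ S → volume.real (A i) = α i) →
      ∫ x in Set.univ.pi A, f x = c * ∏ i, volume.real (A i) := by
    intro S
    induction S using Finset.induction_on with
    | empty =>
      intro A mA dA hu _ hA
      exact setIntegral_pi_of_lt_of_twins hf h01 huv hφ hφ01 hfφ hα hsum H mA dA hu
        fun i hi => hA i hi (Finset.notMem_empty i)
    | insert j S hj ih =>
      intro A mA dA hu hS hA
      by_cases hju : j = u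
      · subst hju
        exact ih A mA dA hu (fun i hi => hS i (Finset.mem_insert_of_mem hi))
          fun i h h' => hA i h (by simp [h, h'])
      refine setIntegral_pi_of_room (j := j) hf h01 mA dA (hα j) ?_ fun B mB dB vB => ?_
      · rw [measureReal_compl_biUnion_erase mA dA]
        have h1 : ∑ i ∈ Finset.univ.erase j, volume.real (A i) <
            ∑ i ∈ Finset.univ.erase j, α i := by
          refine Finset.sum_lt_sum (fun i hi => ?_)
            ⟨u, Finset.mem_erase.2 ⟨Ne.symm hju, Finset.mem_univ u⟩, hu⟩
          by_cases hiu : i = u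
          · exact hiu ▸ hu.le
          by_cases hiS : i ∈ S
          · exact (hS i (Finset.mem_insert_of_mem hiS)).le
          · exact (hA i hiu (by simp [Finset.ne_of_mem_erase hi, hiS])).le
        have := Finset.add_sum_erase Finset.univ α (Finset.mem_univ j)
        linarith
      · refine ih _ (measurableSet_update mA j mB) (disjoint_update dA dB)
          (by simpa [Ne.symm hju] using hu) (fun i hi => ?_) fun i hiu hiS => ?_
        · have : i ≠ j := fun h => hj (h ▸ hi)
          simpa [this] using hS i (Finset.mem_insert_of_mem hi)
        · by_cases hij : i = j
          · subst hij; simpa using vB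
          · simpa [hij] using hA i hiu (by simp [hij, hiS])
  exact main Finset.univ A mA dA (hA u) (fun i _ => hA i)
    fun i _ h => absurd (Finset.mem_univ i) h

end Twins

/-! ### From boxes with disjoint sides to almost every point -/

section Localize

variable {ι : Type*} [Fintype ι]

theorem ae_injective : ∀ᵐ x : ι → I, Function.Injective x := by
  classical
  have : ∀ i j : ι, ∀ᵐ x : ι → I, i ≠ j → x i ≠ x j := by
    intro i j
    by_cases hij : i = j
    · exact Filter.Eventually.of_forall fun x h => absurd hij h
    have hm : MeasurableSet {x : ι → I | x i ≠ x j} :=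
      (measurableSet_eq_fun (measurable_pi_apply i) (measurable_pi_apply j)).compl
    have mp := measurePreserving_update (ι := ι) i
    have h : ∀ᵐ x : ι → I, x i ≠ x j := by
      rw [← mp.map_eq, ae_map_iff mp.aemeasurable hm, Measure.volume_eq_prod]
      refine (Measure.ae_prod_iff_ae_ae (mp.measurable hm)).2 ?_
      refine Filter.Eventually.of_forall fun x => ?_
      simp only [Set.mem_ofPred_eq, Function.update_self,
        Function.update_of_ne (Ne.symm hij)]
      exact Measure.ae_ne volume (x j)
    filter_upwards [h] with x hx _ using hx
  filter_upwards [ae_all_iff.2 fun i => ae_all_iff.2 (this i)] with x hx i j hij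
  by_contra h
  exact hx i j h hij

theorem exists_disjoint_small_nhds {x : ι → I} (hx : Function.Injective x) {α : ι → ℝ}
    (hα : ∀ i, 0 < α i) : ∃ V : ι → Set I, (∀ i, IsOpen (V i)) ∧ (∀ i, x i ∈ V i) ∧
      (∀ i k, i ≠ k → Disjoint (V i) (V k)) ∧ ∀ i, volume.real (V i) < α i := by
  obtain ⟨U, hU, dU⟩ := (Set.finite_range x).t2_separation
  have hO : ∀ i, ∃ O : Set I, {x i} ⊆ O ∧ IsOpen O ∧ volume O < ENNReal.ofReal (α i) := fun i =>
    Set.exists_isOpen_lt_of_lt {x i} _ (by simpa using hα i)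
  choose O hxO oO vO using hO
  refine ⟨fun i => U (x i) ∩ O i, fun i => (hU _).2.inter (oO i),
    fun i => ⟨(hU _).1, hxO i rfl⟩, fun i k hik => ?_, fun i => ?_⟩
  · exact (dU ⟨i, rfl⟩ ⟨k, rfl⟩ (hx.ne hik)).mono Set.inter_subset_left Set.inter_subset_left
  · refine (measureReal_mono Set.inter_subset_right).trans_lt ?_
    exact (ENNReal.lt_ofReal_iff_toReal_lt (measure_ne_top _ _)).1 (vO i)

/-- A function whose integral over all small boxes with disjoint sides is `c` times the volume
equals `c`: near a point with distinct coordinates all sufficiently small boxes have disjoint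
sides, and almost all points have distinct coordinates. -/
theorem ae_eq_const_of_setIntegral_pi {f : (ι → I) → ℝ} (hf : Measurable f)
    (h01 : ∀ x, f x ∈ Set.Icc (0 : ℝ) 1) {α : ι → ℝ} (hα : ∀ i, 0 < α i) {c : ℝ} (hc : 0 < c)
    (H : ∀ A : ι → Set I, (∀ i, MeasurableSet (A i)) → (∀ i k, i ≠ k → Disjoint (A i) (A k)) →
      (∀ i, volume.real (A i) < α i) → ∫ x in Set.univ.pi A, f x = c * ∏ i, volume.real (A i)) :
    ∀ᵐ x, f x = c := by
  have local_eq : ∀ V : ι → Set I, (∀ i, MeasurableSet (V i)) →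
      (∀ i k, i ≠ k → Disjoint (V i) (V k)) → (∀ i, volume.real (V i) < α i) →
      ∀ᵐ x ∂volume.restrict (Set.univ.pi V), f x = c := by
    intro V mV dV vV
    have hfm : Measurable fun x => ENNReal.ofReal (f x) := hf.ennreal_ofReal
    have c0 : ENNReal.ofReal c ≠ 0 := by simpa using hc
    have hpi : Measure.pi (fun i => (volume : Measure I).restrict (V i)) =
        (ENNReal.ofReal c)⁻¹ • (volume.restrict (Set.univ.pi V)).withDensity
          fun x => ENNReal.ofReal (f x) := by
      refine Measure.pi_eq fun s hs => ?_
      have mS : MeasurableSet (Set.univ.pi s) := MeasurableSet.univ_pi hs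
      rw [Measure.smul_apply, withDensity_apply _ mS, Measure.restrict_restrict mS,
        ← Set.pi_inter_distrib, ← ofReal_integral_eq_lintegral_ofReal
          (integrable_of_mem_Icc hf h01).integrableOn
          (Filter.Eventually.of_forall fun x => (h01 x).1),
        H _ (fun i => (hs i).inter (mV i))
          (fun i k h => (dV i k h).mono Set.inter_subset_right Set.inter_subset_right)
          (fun i => (measureReal_mono Set.inter_subset_right).trans_lt (vV i)),
        ENNReal.ofReal_mul hc.le, smul_eq_mul, ← mul_assoc,
        ENNReal.inv_mul_cancel c0 ENNReal.ofReal_ne_top, one_mul,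
        ENNReal.ofReal_prod_of_nonneg fun i _ => measureReal_nonneg]
      refine Finset.prod_congr rfl fun i _ => ?_
      rw [Measure.restrict_apply (hs i), ofReal_measureReal]
    rw [← Measure.restrict_pi_pi, ← volume_pi] at hpi
    have hdens : (volume.restrict (Set.univ.pi V)).withDensity (fun x => ENNReal.ofReal (f x)) =
        (volume.restrict (Set.univ.pi V)).withDensity fun _ => ENNReal.ofReal c := by
      rw [withDensity_const]
      conv_rhs => rw [hpi]
      rw [smul_smul, ENNReal.mul_inv_cancel c0 ENNReal.ofReal_ne_top, one_smul]
    have hfin : ∫⁻ x in Set.univ.pi V, ENNReal.ofReal (f x) ≠ ⊤ := by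
      rw [← ofReal_integral_eq_lintegral_ofReal
          (integrable_of_mem_Icc hf h01).integrableOn
          (Filter.Eventually.of_forall fun x => (h01 x).1)]
      exact ENNReal.ofReal_ne_top
    filter_upwards [(withDensity_eq_iff hfm.aemeasurable aemeasurable_const hfin).1 hdens]
      with x hx
    exact (ENNReal.ofReal_eq_ofReal_iff (h01 x).1 hc.le).1 hx
  have hnull : volume {x : ι → I | Function.Injective x ∧ f x ≠ c} = 0 := by
    refine measure_null_of_locally_null _ fun x hx => ?_
    obtain ⟨V, oV, xV, dV, vV⟩ := exists_disjoint_small_nhds hx.1 hα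
    refine ⟨Set.univ.pi V ∩ {x | Function.Injective x ∧ f x ≠ c}, Filter.inter_mem
      (mem_nhdsWithin_of_mem_nhds ((isOpen_set_pi Set.finite_univ fun i _ => oV i).mem_nhds
        fun i _ => xV i)) self_mem_nhdsWithin, ?_⟩
    have := local_eq V (fun i => (oV i).measurableSet) dV vV
    rw [ae_restrict_iff' (MeasurableSet.univ_pi fun i => (oV i).measurableSet), ae_iff] at this
    refine measure_mono_null ?_ this
    intro y hy h
    exact hy.2.2 (h hy.1)
  filter_upwards [ae_injective, measure_eq_zero_iff_ae_notMem.1 hnull] with x hx hx'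
  by_contra h
  exact hx' ⟨hx, h⟩

end Localize

/-! ### Coordinate projections of the cube -/

theorem measurePreserving_comp_injective {ι κ : Type*} [Fintype ι] [Fintype κ] {g : ι → κ}
    (hg : Function.Injective g) : MeasurePreserving (fun x : κ → I => x ∘ g) := by
  classical
  have hm : Measurable (fun x : κ → I => x ∘ g) :=
    measurable_pi_iff.2 fun i => measurable_pi_apply (g i)
  refine ⟨hm, (Measure.pi_eq fun s hs => ?_).symm⟩
  rw [Measure.map_apply hm (MeasurableSet.univ_pi hs)]
  have : (fun x : κ → I => x ∘ g) ⁻¹' (Set.univ.pi s) =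
      Set.univ.pi (Function.extend g s fun _ => Set.univ) := by
    ext x
    simp only [Set.mem_preimage, Set.mem_univ_pi, Function.comp_apply]
    constructor
    · intro h k
      by_cases hk : ∃ i, g i = k
      · obtain ⟨i, rfl⟩ := hk
        rw [hg.extend_apply]; exact h i
      · rw [Function.extend_apply' _ _ _ hk]; trivial
    · intro h i
      have := h (g i)
      rwa [hg.extend_apply] at this
  rw [this, volume_pi_pi, ← Finset.prod_subset (Finset.subset_univ (Finset.univ.image g)),
    Finset.prod_image hg.injOn]
  · simp only [hg.extend_apply]
  · intro k _ hk
    rw [Function.extend_apply' _ _ _ (by simpa using hk), measure_univ]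

theorem measurePreserving_pair {ι : Type*} [Fintype ι] {i j : ι} (hij : i ≠ j) :
    MeasurePreserving (fun x : ι → I => (x i, x j)) := by
  have hinj : Function.Injective ![i, j] := by
    intro a b h
    fin_cases a <;> fin_cases b <;> simp_all
  have := (volume_preserving_finTwoArrow I).comp (measurePreserving_comp_injective hinj)
  exact this

/-! ### Edge products of a graphon -/

namespace Graphon

variable {m : ℕ}

theorem edgeValue_mem_Icc (W : Graphon) (x : Fin m → I) (e : Sym2 (Fin m)) :
    W.edgeValue x e ∈ Set.Icc (0 : ℝ) 1 := by
  induction e with | _ i j => exact W.mem_unitInterval _ _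

theorem edgeProd_mem_Icc (W : Graphon) (F : SimpleGraph (Fin m)) [DecidableRel F.Adj]
    (x : Fin m → I) : W.edgeProd F x ∈ Set.Icc (0 : ℝ) 1 :=
  ⟨Finset.prod_nonneg fun e _ => (W.edgeValue_mem_Icc x e).1,
    Finset.prod_le_one (fun e _ => (W.edgeValue_mem_Icc x e).1)
      fun e _ => (W.edgeValue_mem_Icc x e).2⟩

theorem measurable_edgeValue {W : Graphon} (hW : Measurable (Function.uncurry W.toFun))
    (e : Sym2 (Fin m)) : Measurable fun x => W.edgeValue x e := by
  induction e with
  | _ i j =>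
    have : Measurable fun x : Fin m → I => (x i, x j) :=
      (measurable_pi_apply i).prodMk (measurable_pi_apply j)
    exact hW.comp this

theorem measurable_edgeProd {W : Graphon} (hW : Measurable (Function.uncurry W.toFun))
    (F : SimpleGraph (Fin m)) [DecidableRel F.Adj] : Measurable fun x => W.edgeProd F x :=
  Finset.measurable_prod _ fun e _ => measurable_edgeValue hW e

theorem edgeValue_update_of_notMem (W : Graphon) (x : Fin m → I) {u : Fin m} (s : I)
    {e : Sym2 (Fin m)} (he : u ∉ e) :
    W.edgeValue (Function.update x u s) e = W.edgeValue x e := by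
  induction e with
  | _ i j =>
    rw [Sym2.mem_iff, not_or] at he
    show W.toFun (Function.update x u s i) (Function.update x u s j) = W.toFun (x i) (x j)
    rw [Function.update_of_ne (Ne.symm he.1), Function.update_of_ne (Ne.symm he.2)]

theorem prod_edgeValue_incident (W : Graphon) (F : SimpleGraph (Fin m)) [DecidableRel F.Adj]
    (x : Fin m → I) (u : Fin m) :
    ∏ e ∈ F.edgeFinset with u ∈ e, W.edgeValue x e =
      ∏ j ∈ F.neighborFinset u, W.toFun (x u) (x j) := by
  have : (F.edgeFinset.filter fun e => u ∈ e) = (F.neighborFinset u).image fun j => s(u, j) := by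
    ext e
    simp only [Finset.mem_filter, SimpleGraph.mem_edgeFinset, Finset.mem_image,
      SimpleGraph.mem_neighborFinset]
    constructor
    · rintro ⟨he, hu⟩
      obtain ⟨j, rfl⟩ := hu
      exact ⟨j, he, rfl⟩
    · rintro ⟨j, hj, rfl⟩
      exact ⟨hj, Sym2.mem_mk_left u j⟩
  rw [this, Finset.prod_image fun i _ j _ h => Sym2.congr_right.1 h]
  rfl

theorem edgeProd_eq_star_mul (W : Graphon) (F : SimpleGraph (Fin m)) [DecidableRel F.Adj]
    (x : Fin m → I) (u : Fin m) :
    W.edgeProd F x = (∏ j ∈ F.neighborFinset u, W.toFun (x u) (x j)) *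
      ∏ e ∈ F.edgeFinset with u ∉ e, W.edgeValue x e := by
  rw [← prod_edgeValue_incident, edgeProd, Finset.prod_filter_mul_prod_filter_not]

/-- The product over the edges avoiding both `u` and `v`. -/
def edgeProdAvoiding (W : Graphon) (F : SimpleGraph (Fin m)) [DecidableRel F.Adj] (u v : Fin m)
    (x : Fin m → I) : ℝ :=
  ∏ e ∈ F.edgeFinset with u ∉ e ∧ v ∉ e, W.edgeValue x e

/-- One twin's contribution to `edgeProd` when it is placed at `s`. The square root of the
contribution of the edges away from the twins is included, so that `edgeProd` becomes the product
of the two twins' contributions. -/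
noncomputable def twinFactor (W : Graphon) (F : SimpleGraph (Fin m)) [DecidableRel F.Adj]
    (u v : Fin m) (x : Fin m → I) (s : I) : ℝ :=
  √(W.edgeProdAvoiding F u v x) * ∏ j ∈ F.neighborFinset u, W.toFun s (x j)

theorem edgeProdAvoiding_mem_Icc (W : Graphon) (F : SimpleGraph (Fin m)) [DecidableRel F.Adj]
    (u v : Fin m) (x : Fin m → I) : W.edgeProdAvoiding F u v x ∈ Set.Icc (0 : ℝ) 1 :=
  ⟨Finset.prod_nonneg fun e _ => (W.edgeValue_mem_Icc x e).1,
    Finset.prod_le_one (fun e _ => (W.edgeValue_mem_Icc x e).1)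
      fun e _ => (W.edgeValue_mem_Icc x e).2⟩

theorem twinFactor_mem_Icc (W : Graphon) (F : SimpleGraph (Fin m)) [DecidableRel F.Adj]
    (u v : Fin m) (x : Fin m → I) (s : I) : W.twinFactor F u v x s ∈ Set.Icc (0 : ℝ) 1 := by
  have h0 : 0 ≤ ∏ j ∈ F.neighborFinset u, W.toFun s (x j) :=
    Finset.prod_nonneg fun j _ => (W.mem_unitInterval _ _).1
  exact ⟨mul_nonneg (Real.sqrt_nonneg _) h0, mul_le_one₀
    (Real.sqrt_le_one.2 (W.edgeProdAvoiding_mem_Icc F u v x).2) h0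
    (Finset.prod_le_one (fun j _ => (W.mem_unitInterval _ _).1)
      fun j _ => (W.mem_unitInterval _ _).2)⟩

theorem measurable_twinFactor {W : Graphon} (hW : Measurable (Function.uncurry W.toFun))
    (F : SimpleGraph (Fin m)) [DecidableRel F.Adj] (u v : Fin m) :
    Measurable (Function.uncurry (W.twinFactor F u v)) := by
  have h1 : Measurable fun x => W.edgeProdAvoiding F u v x :=
    Finset.measurable_prod _ fun e _ => measurable_edgeValue hW e
  exact (h1.sqrt.comp measurable_fst).mul (Finset.measurable_prod _ fun j _ =>
    hW.comp (measurable_snd.prodMk ((measurable_pi_apply j).comp measurable_fst)))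

theorem edgeProd_update_update (W : Graphon) {F : SimpleGraph (Fin m)} [DecidableRel F.Adj]
    {u v : Fin m} (h : F.AreTwins u v) (x : Fin m → I) (s t : I) :
    W.edgeProd F (Function.update (Function.update x u s) v t) =
      W.twinFactor F u v x s * W.twinFactor F u v x t := by
  obtain ⟨huv, hN⟩ := h
  have hN' : F.neighborFinset v = F.neighborFinset u := by
    ext j; simpa using (Set.ext_iff.1 hN j).symm
  have hvu : v ∉ F.neighborFinset u := by
    rw [← hN']; simp
  have huu : u ∉ F.neighborFinset u := by simp
  set y := Function.update (Function.update x u s) v t with hy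
  have yu : y u = s := by simp [hy, huv]
  have yv : y v = t := by simp [hy]
  have yj : ∀ j ∈ F.neighborFinset u, y j = x j := by
    intro j hj
    have h1 : j ≠ v := fun h => hvu (h ▸ hj)
    have h2 : j ≠ u := fun h => huu (h ▸ hj)
    simp [hy, h1, h2]
  have star : ∀ r : I, ∏ j ∈ F.neighborFinset u, W.toFun r (y j) =
      ∏ j ∈ F.neighborFinset u, W.toFun r (x j) := fun r =>
    Finset.prod_congr rfl fun j hj => by rw [yj j hj]
  have hv : ∏ e ∈ F.edgeFinset with u ∉ e, W.edgeValue y e =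
      (∏ j ∈ F.neighborFinset u, W.toFun t (x j)) * W.edgeProdAvoiding F u v x := by
    rw [← Finset.prod_filter_mul_prod_filter_not _ (fun e => v ∈ e), Finset.filter_filter,
      Finset.filter_filter]
    congr 1
    · have : (F.edgeFinset.filter fun e => u ∉ e ∧ v ∈ e) =
          F.edgeFinset.filter fun e => v ∈ e := by
        refine Finset.filter_congr fun e he => and_iff_right_of_imp fun hve hue => hvu ?_
        rw [(Sym2.mem_and_mem_iff huv).1 ⟨hue, hve⟩] at he
        simpa using he
      rw [this, prod_edgeValue_incident, hN', yv, star]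
    · refine Finset.prod_congr rfl fun e he => ?_
      obtain ⟨-, h1, h2⟩ := Finset.mem_filter.1 he
      rw [hy, edgeValue_update_of_notMem _ _ _ h2, edgeValue_update_of_notMem _ _ _ h1]
  rw [edgeProd_eq_star_mul W F y u, hv, yu, star, twinFactor, twinFactor]
  have := Real.mul_self_sqrt (W.edgeProdAvoiding_mem_Icc F u v x).1
  linear_combination -((∏ j ∈ F.neighborFinset u, W.toFun s (x j)) *
    ∏ j ∈ F.neighborFinset u, W.toFun t (x j)) * this

/-! ### Weighted cliques in which all copies of `F` have equal weight -/

/-- Moving one vertex `a` of a copy of `F` with nonzero weight to a new place `s` does not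
change the product over the edges at `a`, if it does not change the weight of the copy. -/
theorem star_eq_of_edgeProd_eq (W : Graphon) (F : SimpleGraph (Fin m)) [DecidableRel F.Adj]
    {x : Fin m → I} {a : Fin m} {s : I} (h0 : W.edgeProd F x ≠ 0)
    (h : W.edgeProd F (Function.update x a s) = W.edgeProd F x) :
    ∏ j ∈ F.neighborFinset a, W.toFun s (x j) =
      ∏ j ∈ F.neighborFinset a, W.toFun (x a) (x j) := by
  have e : ∏ e ∈ F.edgeFinset with a ∉ e, W.edgeValue (Function.update x a s) e =
      ∏ e ∈ F.edgeFinset with a ∉ e, W.edgeValue x e :=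
    Finset.prod_congr rfl fun e he =>
      W.edgeValue_update_of_notMem x s (Finset.mem_filter.1 he).2
  have st : ∏ j ∈ F.neighborFinset a, W.toFun (Function.update x a s a)
      (Function.update x a s j) = ∏ j ∈ F.neighborFinset a, W.toFun s (x j) := by
    refine Finset.prod_congr rfl fun j hj => ?_
    have : j ≠ a := fun h => by subst h; simp at hj
    rw [Function.update_self, Function.update_of_ne this]
  rw [edgeProd_eq_star_mul _ _ _ a, edgeProd_eq_star_mul _ _ x a, e, st] at h
  rw [edgeProd_eq_star_mul _ _ _ a] at h0
  exact mul_right_cancel₀ (right_ne_zero_of_mul h0) h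

/-- If all copies of `F` in a weighted clique with at least two extra vertices have the same
nonzero weight, then two edges sharing an endpoint have the same weight. -/
theorem toFun_eq_of_forall_edgeProd_eq (W : Graphon) {F : SimpleGraph (Fin m)}
    [DecidableRel F.Adj] {a b : Fin m} (hab : F.Adj a b) {c : ℝ} (hc : 0 < c)
    {x : Fin (m + 2) → I}
    (H : ∀ g : Fin m → Fin (m + 2), Function.Injective g → W.edgeProd F (x ∘ g) = c)
    {k s l : Fin (m + 2)} (hks : k ≠ s) (hkl : k ≠ l) (hsl : s ≠ l) :
    W.toFun (x k) (x l) = W.toFun (x s) (x l) := by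
  have hm : 2 ≤ m := by
    have := Finset.card_le_univ ({a, b} : Finset (Fin m))
    rwa [Finset.card_pair hab.ne, Fintype.card_fin] at this
  obtain ⟨t, ht⟩ : ∃ t, t ∉ ({k, s, l} : Finset (Fin (m + 2))) := by
    by_contra hcon
    push Not at hcon
    have h1 := Finset.card_le_card (fun t _ => hcon t : Finset.univ ⊆ _)
    have h2 := Finset.card_le_three (a := k) (b := s) (c := l)
    rw [Finset.card_univ, Fintype.card_fin] at h1
    omega
  simp only [Finset.mem_insert, Finset.mem_singleton, not_or] at ht
  obtain ⟨htk, hts, htl⟩ := ht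
  have hT : Fintype.card (Fin m) = (({s, t} : Finset (Fin (m + 2)))ᶜ).card := by
    rw [Finset.card_compl, Finset.card_pair (Ne.symm hts)]; simp
  obtain ⟨g', hg'⟩ := Finset.exists_equiv_extend_of_card_eq hT
    (s := {a, b}) (f := fun i => if i = a then k else l)
    (by
      intro y hy
      simp only [Finset.mem_image, Finset.mem_insert, Finset.mem_singleton] at hy
      obtain ⟨i, -, rfl⟩ := hy
      split_ifs
      · simp [hks, Ne.symm htk]
      · simp [hsl.symm, Ne.symm htl])
    (by
      intro i hi j hj hij
      simp only [Finset.coe_insert, Finset.coe_singleton, Set.mem_insert_iff,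
        Set.mem_singleton_iff] at hi hj
      rcases hi with rfl | rfl <;> rcases hj with rfl | rfl <;>
        simp_all [hab.ne.symm])
  set g : Fin m → Fin (m + 2) := fun i => (g' i : Fin (m + 2)) with hg
  have ginj : Function.Injective g := Subtype.val_injective.comp g'.injective
  have ga : g a = k := by simpa using hg' a (by simp)
  have gb : g b = l := by simpa [hab.ne.symm] using hg' b (by simp)
  have gs : ∀ i, g i ≠ s := fun i h => by
    have := (g' i).2; simp only [Finset.mem_compl, Finset.mem_insert, not_or] at this
    exact this.1 h
  have gt : ∀ i, g i ≠ t := fun i h => by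
    have := (g' i).2
    simp only [Finset.mem_compl, Finset.mem_insert, Finset.mem_singleton, not_or] at this
    exact this.2 h
  have inj_update : ∀ (h : Fin m → Fin (m + 2)) (i : Fin m) (r : Fin (m + 2)),
      Function.Injective h → (∀ j, h j ≠ r) → Function.Injective (Function.update h i r) := by
    intro h i r hh hr i₁ i₂ he
    by_cases h1 : i₁ = i <;> by_cases h2 : i₂ = i
    · rw [h1, h2]
    · subst h1; simp only [Function.update_self, Function.update_of_ne h2] at he
      exact absurd he.symm (hr i₂)
    · subst h2; simp only [Function.update_self, Function.update_of_ne h1] at he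
      exact absurd he (hr i₁)
    · simp only [Function.update_of_ne h1, Function.update_of_ne h2] at he
      exact hh he
  -- the product over the edges at `a` is unchanged when `a` moves from its place to `s`
  have move : ∀ h : Fin m → Fin (m + 2), Function.Injective h → (∀ j, h j ≠ s) →
      ∏ j ∈ F.neighborFinset a, W.toFun (x s) (x (h j)) =
        ∏ j ∈ F.neighborFinset a, W.toFun (x (h a)) (x (h j)) := by
    intro h hh hs
    refine W.star_eq_of_edgeProd_eq F (x := x ∘ h) ((H h hh).symm ▸ hc.ne') ?_
    rw [H h hh, ← Function.comp_update, H _ (inj_update h a s hh hs)]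
  have pos : ∀ h : Fin m → Fin (m + 2), Function.Injective h → ∀ j ∈ F.neighborFinset a,
      0 < W.toFun (x (h a)) (x (h j)) := by
    intro h hh j hj
    have := H h hh
    rw [edgeProd_eq_star_mul _ _ _ a] at this
    have h0 := left_ne_zero_of_mul (this.trans_ne hc.ne')
    exact lt_of_le_of_ne (W.mem_unitInterval _ _).1
      (Ne.symm (Finset.prod_ne_zero_iff.1 h0 j hj))
  -- an edge from `s` belongs to the copy in which `a` has moved to `s`
  have pos' : ∀ h : Fin m → Fin (m + 2), Function.Injective h → (∀ j, h j ≠ s) →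
      ∀ j ∈ F.neighborFinset a, 0 < W.toFun (x s) (x (h j)) := by
    intro h hh hs j hj
    have hja : j ≠ a := fun h => by subst h; simp at hj
    have := pos _ (inj_update h a s hh hs) j hj
    rwa [Function.update_self, Function.update_of_ne hja] at this
  -- moving a neighbour `j` to `t` as well shows that the ratio does not depend on `j`
  have ratio : ∀ j ∈ F.neighborFinset a,
      W.toFun (x k) (x (g j)) / W.toFun (x s) (x (g j)) =
        W.toFun (x k) (x t) / W.toFun (x s) (x t) := by
    intro j hj
    have hja : a ≠ j := fun h => by subst h; simp at hj
    have hginj := inj_update g j t ginj gt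
    have hgs : ∀ i, Function.update g j t i ≠ s := by
      intro i
      by_cases hi : i = j
      · subst hi; simpa using hts
      · simpa [hi] using gs i
    have e1 := move g ginj gs
    have e2 := move _ hginj hgs
    have p1 := fun i hi => (pos g ginj i hi)
    have p2 := pos' g ginj gs
    have p3 := pos' _ hginj hgs j hj
    rw [Function.update_self] at p3
    rw [ga] at e1 p1
    rw [Function.update_of_ne hja, ga] at e2
    rw [← Finset.mul_prod_erase _ _ hj, ← Finset.mul_prod_erase _ _ hj] at e1 e2
    have er : ∀ r : I, ∏ i ∈ (F.neighborFinset a).erase j,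
        W.toFun r (x (Function.update g j t i)) =
          ∏ i ∈ (F.neighborFinset a).erase j, W.toFun r (x (g i)) := fun r =>
      Finset.prod_congr rfl fun i hi => by rw [Function.update_of_ne (Finset.ne_of_mem_erase hi)]
    rw [er, er, Function.update_self] at e2
    have q1 : 0 < ∏ i ∈ (F.neighborFinset a).erase j, W.toFun (x k) (x (g i)) :=
      Finset.prod_pos fun i hi => p1 i (Finset.mem_of_mem_erase hi)
    have q2 : 0 < ∏ i ∈ (F.neighborFinset a).erase j, W.toFun (x s) (x (g i)) :=
      Finset.prod_pos fun i hi => p2 i (Finset.mem_of_mem_erase hi)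
    rw [div_eq_div_iff (p2 j hj).ne' p3.ne']
    refine mul_right_cancel₀ (mul_pos q1 q2).ne' ?_
    linear_combination (W.toFun (x s) (x (g j)) *
      ∏ i ∈ (F.neighborFinset a).erase j, W.toFun (x s) (x (g i))) * e2 -
      (W.toFun (x s) (x t) * ∏ i ∈ (F.neighborFinset a).erase j, W.toFun (x s) (x (g i))) * e1
  have hb : b ∈ F.neighborFinset a := by simpa using hab
  have hq : (W.toFun (x k) (x t) / W.toFun (x s) (x t)) ^ (F.neighborFinset a).card = 1 := by
    rw [← Finset.prod_const, ← Finset.prod_congr rfl ratio, Finset.prod_div_distrib,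
      move g ginj gs, ga]
    refine div_self (Finset.prod_pos fun j hj => ?_).ne'
    have := pos g ginj j hj
    rwa [ga] at this
  have hq1 := (pow_eq_one_iff_of_nonneg (div_nonneg (W.mem_unitInterval _ _).1
    (W.mem_unitInterval _ _).1) (Finset.card_ne_zero_of_mem hb)).1 hq
  have := (ratio b hb).trans hq1
  rw [gb] at this
  refine (div_eq_one_iff_eq ?_).1 this
  have := pos' g ginj gs b hb
  rw [gb] at this
  exact this.ne'

theorem toFun_eq_of_forall_edgeProd_eq_pow (W : Graphon) {F : SimpleGraph (Fin m)}
    [DecidableRel F.Adj] {a b : Fin m} (hab : F.Adj a b) {p : ℝ} (hp : 0 < p)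
    {x : Fin (m + 2) → I} (H : ∀ g : Fin m → Fin (m + 2), Function.Injective g →
      W.edgeProd F (x ∘ g) = p ^ F.edgeFinset.card)
    {k l : Fin (m + 2)} (hkl : k ≠ l) : W.toFun (x k) (x l) = p := by
  have left : ∀ k s l : Fin (m + 2), k ≠ l → s ≠ l →
      W.toFun (x k) (x l) = W.toFun (x s) (x l) := by
    intro k s l hk hs
    by_cases hks : k = s
    · rw [hks]
    · exact W.toFun_eq_of_forall_edgeProd_eq hab (pow_pos hp _) H hks hk hs
  have all : ∀ k' l' : Fin (m + 2), k' ≠ l' → W.toFun (x k') (x l') = W.toFun (x k) (x l) := by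
    intro k' l' h
    have right : ∀ r, r ≠ k' → W.toFun (x k') (x l') = W.toFun (x k') (x r) := by
      intro r hr
      rw [W.symm (x k') (x l'), W.symm (x k') (x r)]
      exact left l' r k' h.symm hr
    by_cases hk' : k' = l
    · rw [right k (hk' ▸ hkl), hk', W.symm]
    · rw [right l (Ne.symm hk')]
      exact left k' k l hk' hkl
  have := H (Fin.castAdd 2) (Fin.castAdd_injective m 2)
  have hconst : W.edgeProd F (x ∘ Fin.castAdd 2) =
      W.toFun (x k) (x l) ^ F.edgeFinset.card := by
    rw [edgeProd, ← Finset.prod_const]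
    refine Finset.prod_congr rfl fun e he => ?_
    induction e with
    | _ i j =>
      have hij : F.Adj i j := by simpa using he
      exact all _ _ ((Fin.castAdd_injective m 2).ne hij.ne)
  rw [hconst] at this
  have hcard : F.edgeFinset.card ≠ 0 := Finset.card_ne_zero_of_mem
    (SimpleGraph.mem_edgeFinset.2 ((SimpleGraph.mem_edgeSet F).2 hab))
  exact (pow_left_inj₀ (W.mem_unitInterval _ _).1 hp.le hcard).1 this

/-! ### Almost everywhere statements about graphons -/

theorem aeEqConst_of_ae_edgeProd_eq {W : Graphon} (hW : Measurable (Function.uncurry W.toFun))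
    {F : SimpleGraph (Fin m)} [DecidableRel F.Adj] {a b : Fin m} (hab : F.Adj a b) {p : ℝ}
    (hp : 0 < p) (h : ∀ᵐ x, W.edgeProd F x = p ^ F.edgeFinset.card) : W.AEEqConst p := by
  have hall : ∀ᵐ x : Fin (m + 2) → I, ∀ g : Fin m → Fin (m + 2), Function.Injective g →
      W.edgeProd F (x ∘ g) = p ^ F.edgeFinset.card := by
    refine ae_all_iff.2 fun g => ?_
    by_cases hg : Function.Injective g
    · filter_upwards [(measurePreserving_comp_injective hg).quasiMeasurePreserving.ae h]
        with x hx _ using hx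
    · exact Filter.Eventually.of_forall fun x h => absurd h hg
  have h01 : (0 : Fin (m + 2)) ≠ 1 := by simp
  have mp := measurePreserving_pair h01
  have : ∀ᵐ z ∂(Measure.map (fun x : Fin (m + 2) → I => (x 0, x 1)) volume),
      W.toFun z.1 z.2 = p := by
    refine (ae_map_iff mp.aemeasurable (measurableSet_eq_fun hW measurable_const)).2 ?_
    filter_upwards [hall] with x hx
    exact W.toFun_eq_of_forall_edgeProd_eq_pow hab hp hx h01
  rwa [mp.map_eq] at this

theorem edgeProd_congr_ae {W W' : Graphon} (F : SimpleGraph (Fin m)) [DecidableRel F.Adj]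
    (h : ∀ᵐ z : I × I, W.toFun z.1 z.2 = W'.toFun z.1 z.2) :
    ∀ᵐ x, W.edgeProd F x = W'.edgeProd F x := by
  have : ∀ᵐ x : Fin m → I, ∀ e ∈ F.edgeFinset, W.edgeValue x e = W'.edgeValue x e := by
    refine (Filter.eventually_all_finset _).2 fun e he => ?_
    induction e with
    | _ i j =>
      have hij : F.Adj i j := by simpa using he
      exact (measurePreserving_pair hij.ne).quasiMeasurePreserving.ae h
  filter_upwards [this] with x hx using Finset.prod_congr rfl hx

theorem SatisfiesP.congr_ae {W W' : Graphon} {F : SimpleGraph (Fin m)} [DecidableRel F.Adj]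
    {α : Fin m → ℝ} {p : ℝ} (hW : W.SatisfiesP F α p)
    (h : ∀ᵐ z : I × I, W.toFun z.1 z.2 = W'.toFun z.1 z.2) : W'.SatisfiesP F α p := by
  intro A mA dA vA
  rw [← hW A mA dA vA]
  exact integral_congr_ae (ae_restrict_of_ae ((edgeProd_congr_ae F h).mono fun _ hx => hx.symm))

/-- Every graphon agrees almost everywhere with a Borel measurable one. -/
theorem exists_measurable_ae_eq (W : Graphon) : ∃ W' : Graphon,
    Measurable (Function.uncurry W'.toFun) ∧
      ∀ᵐ z : I × I, W.toFun z.1 z.2 = W'.toFun z.1 z.2 := by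
  set g : I × I → ℝ := W.aemeasurable.mk _ with hg
  have hgm : Measurable g := W.aemeasurable.measurable_mk
  have hgW : ∀ᵐ z : I × I, W.toFun z.1 z.2 = g z := W.aemeasurable.ae_eq_mk
  have hm : Measurable fun z : I × I => max 0 (min 1 ((g z + g z.swap) / 2)) :=
    measurable_const.max (measurable_const.min
      ((hgm.add (hgm.comp measurable_swap)).div_const 2))
  refine ⟨⟨fun x y => max 0 (min 1 ((g (x, y) + g (y, x)) / 2)), hm.aemeasurable,
    fun x y => by rw [add_comm], fun x y => ⟨le_max_left _ _,
      max_le zero_le_one (min_le_left _ _)⟩⟩, hm, ?_⟩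
  have hsw : ∀ᵐ z : I × I, W.toFun z.swap.1 z.swap.2 = g z.swap :=
    (Measure.measurePreserving_swap (μ := (volume : Measure I))
      (ν := (volume : Measure I))).quasiMeasurePreserving.ae hgW
  filter_upwards [hgW, hsw] with z h1 h2
  have h2' : g (z.2, z.1) = W.toFun z.1 z.2 := by
    rw [W.symm]; exact h2.symm
  have h1' : g (z.1, z.2) = W.toFun z.1 z.2 := h1.symm
  show _ = max 0 (min 1 ((g (z.1, z.2) + g (z.2, z.1)) / 2))
  obtain ⟨l, r⟩ := W.mem_unitInterval z.1 z.2
  rw [h1', h2', add_self_div_two, min_eq_right r, max_eq_right l]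

theorem satisfiesP_of_aeEqConst {W : Graphon} {F : SimpleGraph (Fin m)} [DecidableRel F.Adj]
    {α : Fin m → ℝ} {p : ℝ} (h : W.AEEqConst p) : W.SatisfiesP F α p := by
  intro A mA dA vA
  have hc : ∀ᵐ x : Fin m → I, W.edgeProd F x = p ^ F.edgeFinset.card := by
    have : ∀ᵐ x : Fin m → I, ∀ e ∈ F.edgeFinset, W.edgeValue x e = p := by
      refine (Filter.eventually_all_finset _).2 fun e he => ?_
      induction e with
      | _ i j =>
        have hij : F.Adj i j := by simpa using he
        exact (measurePreserving_pair hij.ne).quasiMeasurePreserving.ae h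
    filter_upwards [this] with x hx
    rw [edgeProd, Finset.prod_congr rfl hx, Finset.prod_const]
  rw [integral_congr_ae (ae_restrict_of_ae hc), setIntegral_const, smul_eq_mul, mul_comm,
    Measure.real, volume_pi_pi, ENNReal.toReal_prod]
  exact congrArg _ (Finset.prod_congr rfl fun i _ => vA i)

end Graphon

theorem theorem3 {m : ℕ} (F : SimpleGraph (Fin m)) [DecidableRel F.Adj]
    (hedge : F.edgeSet.Nonempty)
    (htwins : ∃ u v : Fin m, F.AreTwins u v)
    (p : ℝ) (hp0 : 0 < p) (hp1 : p ≤ 1)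
    (α : Fin m → ℝ) (hα : ∀ i, α i ∈ Set.Ioo (0 : ℝ) 1) (hsum : ∑ i, α i ≤ 1) :
    IsQuasiRandomProperty F α p := by
  intro W
  refine ⟨fun hW => ?_, Graphon.satisfiesP_of_aeEqConst⟩
  obtain ⟨u, v, huv⟩ := htwins
  obtain ⟨e, he⟩ := hedge
  obtain ⟨W', mW', hWW'⟩ := W.exists_measurable_ae_eq
  have hα0 : ∀ i, 0 < α i := fun i => (hα i).1
  have hconst := ae_eq_const_of_setIntegral_pi (Graphon.measurable_edgeProd mW' F)
    (W'.edgeProd_mem_Icc F) hα0 (pow_pos hp0 F.edgeFinset.card)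
    fun A mA dA vA => setIntegral_pi_of_forall_lt (Graphon.measurable_edgeProd mW' F)
      (W'.edgeProd_mem_Icc F) huv.1 (Graphon.measurable_twinFactor mW' F u v)
      (W'.twinFactor_mem_Icc F u v) (W'.edgeProd_update_update huv) hα0 hsum
      (fun A mA dA vA => by
        rw [hW.congr_ae hWW' A mA dA vA, Finset.prod_congr rfl fun i _ => (vA i)])
      mA dA vA
  have hW' : W'.AEEqConst p := by
    induction e with
    | _ a b => exact Graphon.aeEqConst_of_ae_edgeProd_eq mW' he hp0 hconst
  filter_upwards [hWW', hW'] with z h1 h2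
  rw [h1, h2]
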